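/- Let $d\in\mathbb N$ and let $\Lambda=(\mathbb Z/L\mathbb Z)^d$ be the $d$-dimensional cubic lattice with periodic boundary conditions and linear size $L\ge 1$, with $\ell^1$-distance $|x-y|_1$ on the torus. Let $T_{x,y}=1$ if $|x-y|_1=1$ and $T_{x,y}=0$ otherwise, let $\Delta=T-2d$ be the discrete Laplacian, a complex Hermitian $\Lambda\times\Lambda$ matrix, and put $K_\mu=-\Delta-\mu$. For Hermitian $\Lambda\times\Lambda$ matrices $\gamma_\uparrow,\gamma_\downarrow$ define the HFz functional $$\mathcal E_{\mu,U}(\gamma_\uparrow,\gamma_\downarrow)=\mathrm{Tr}\{K_\mu(\gamma_\uparrow+\gamma_\downarrow)\}+U\sum_{x\in\Lambda}(\gamma_\uparrow)_{x,x}(\gamma_\downarrow)_{x,x}.$$ For every $0<\mu<4d$ there exist a finite length $L_\#$ and a finite $U_\#\ge 0$, depending only on $\mu$ and $d$, such that for all even $L\ge L_\#$ and all real $U\ge U_\#$ the following holds. (1) The minimum of $\mathcal E_{\mu,U}$ over all pairs of orthogonal projections ($\gamma_\sigma=\gamma_\sigma^*=\gamma_\sigma^2$ for $\sigma=\uparrow,\downarrow$),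 and likewise its minimum over all pairs of one-particle density matrices (Hermitian matrices with $0\le\gamma_\uparrow,\gamma_\downarrow\le1$), is attained and equals $\mathrm{Tr}[-\Delta-\mu]_-$, the sum of the negative eigenvalues of $-\Delta-\mu$, counted with multiplicity. (2) If $\mu$ is not an eigenvalue of $-\Delta$ and $(\gamma_\uparrow,\gamma_\downarrow)$ minimizes $\mathcal E_{\mu,U}$ over pairs of one-particle density matrices, then either $\gamma_\uparrow=\mathbb 1[-\Delta<\mu]$ and $\gamma_\downarrow=0$, or $\gamma_\uparrow=0$ and $\gamma_\downarrow=\mathbb 1[-\Delta<\mu]$, where $\mathbb 1[-\Delta<\mu]$ is the spectral projection of $-\Delta$ onto $(-\infty,\mu)$. -/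

import Mathlib

noncomputable section

namespace HFz

open scoped ComplexOrder

/-- The `d`-dimensional cubic lattice of linear size `L` with periodic boundary conditions. -/
abbrev Lattice (d L : ℕ) : Type := Fin d → ZMod L

/-- The `ℓ¹`-distance `|x - y|₁` on the torus: in each coordinate, the length of the shortest way
around the circle from `x ν` to `y ν`. -/
def dist1 {d L : ℕ} (x y : Lattice d L) : ℕ :=
  ∑ ν : Fin d, (x ν - y ν).valMinAbs.natAbs

theorem dist1_comm {d L : ℕ} (x y : Lattice d L) : dist1 x y = dist1 y x := by
  unfold dist1
  refine Finset.sum_congr rfl fun ν _ => ?_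
  rw [← neg_sub, ZMod.natAbs_valMinAbs_neg]

/-- The nearest-neighbor hopping matrix `T`. -/
def hopping (d L : ℕ) : Matrix (Lattice d L) (Lattice d L) ℂ :=
  Matrix.of fun x y => if dist1 x y = 1 then 1 else 0

/-- The discrete Laplacian `Δ = T - 2d`. -/
def laplacian (d L : ℕ) : Matrix (Lattice d L) (Lattice d L) ℂ :=
  hopping d L - (2 * (d : ℂ)) • (1 : Matrix (Lattice d L) (Lattice d L) ℂ)

/-- The one-particle operator `K_μ = -Δ - μ`. -/
def kinetic (d L : ℕ) (μ : ℝ) : Matrix (Lattice d L) (Lattice d L) ℂ :=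
  -laplacian d L - (μ : ℂ) • (1 : Matrix (Lattice d L) (Lattice d L) ℂ)

theorem hopping_isHermitian (d L : ℕ) : (hopping d L).IsHermitian := by
  ext x y
  simp only [hopping, Matrix.conjTranspose_apply, Matrix.of_apply, dist1_comm y x]
  split_ifs <;> simp

theorem neg_laplacian_isHermitian (d L : ℕ) : (-laplacian d L).IsHermitian := by
  refine Matrix.IsHermitian.neg (Matrix.IsHermitian.sub (hopping_isHermitian d L) ?_)
  ext x y
  by_cases h : x = y
  · simp [h]
  · simp [h, Ne.symm h]

theorem kinetic_isHermitian (d L : ℕ) (μ : ℝ) : (kinetic d L μ).IsHermitian := by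
  refine Matrix.IsHermitian.sub (neg_laplacian_isHermitian d L) ?_
  ext x y
  by_cases h : x = y
  · simp [h]
  · simp [h, Ne.symm h]

section Matrices

variable {n : Type*} [Fintype n] [DecidableEq n]

/-- `Tr [A]₋`, the (nonpositive) sum of the negative eigenvalues of a Hermitian matrix `A`, counted
with multiplicity. -/
def negTrace {A : Matrix n n ℂ} (hA : A.IsHermitian) : ℝ :=
  ∑ i, min (hA.eigenvalues i) 0

/-- The spectral projection `1[A < c]` of a Hermitian matrix `A` onto `(-∞, c)`. -/
def spectralProjLT {A : Matrix n n ℂ} (hA : A.IsHermitian) (c : ℝ) : Matrix n n ℂ :=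
  hA.cfc (Set.indicator (Set.Iio c) 1)

/-- A one-particle density matrix: a Hermitian matrix `γ` with `0 ≤ γ ≤ 1`. -/
def IsDensityMatrix (γ : Matrix n n ℂ) : Prop :=
  γ.PosSemidef ∧ (1 - γ).PosSemidef

end Matrices

variable {d L : ℕ} [NeZero L]

/-- The HFz functional
`Tr (K_μ (γ↑ + γ↓)) + U ∑ x, ρ↑ x * ρ↓ x`, where `ρ x` is the diagonal entry of `γ` at `x`.
For Hermitian arguments the traces and the diagonal entries are real, so taking real parts
only changes the type. -/
def functional (μ U : ℝ) (γup γdn : Matrix (Lattice d L) (Lattice d L) ℂ) : ℝ :=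
  (Matrix.trace (kinetic d L μ * (γup + γdn))).re
    + U * ∑ x : Lattice d L, (γup x x).re * (γdn x x).re

/-- The values of the HFz functional on pairs of orthogonal projections. -/
def projectionEnergies (d L : ℕ) [NeZero L] (μ U : ℝ) : Set ℝ :=
  {E | ∃ γup γdn : Matrix (Lattice d L) (Lattice d L) ℂ,
    IsStarProjection γup ∧ IsStarProjection γdn ∧ functional μ U γup γdn = E}

/-- The values of the HFz functional on pairs of one-particle density matrices. -/
def densityEnergies (d L : ℕ) [NeZero L] (μ U : ℝ) : Set ℝ :=
  {E | ∃ γup γdn : Matrix (Lattice d L) (Lattice d L) ℂ,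
    IsDensityMatrix γup ∧ IsDensityMatrix γdn ∧ functional μ U γup γdn = E}

/-- `(γup, γdn)` minimizes the HFz functional over pairs of one-particle density matrices. -/
def IsMinimizer (μ U : ℝ) (γup γdn : Matrix (Lattice d L) (Lattice d L) ℂ) : Prop :=
  IsDensityMatrix γup ∧ IsDensityMatrix γdn ∧
    IsLeast (densityEnergies d L μ U) (functional μ U γup γdn)

end HFz

end

/-! A fully polarized Fermi sea has no interaction energy, so the point is a lower bound with a
positive excess for everything else. Given density matrices `X`, `Y`, let `s` be the sign of the
local magnetization, and let `γ` be `X` compressed to `s = 1` plus `Y` compressed to `s = -1`. This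
`γ` is again a density matrix, and it commutes with `s`.

Let `H` and `G` project onto momenta of energy below `μ - η` and above `μ + η`. The kinetic energy
of `γ` exceeds that of the Fermi sea by at least `η * D`, with `D = Tr (G γ) + Tr (H (1 - γ))`
(`le_trace_multiplier_mul`). Commutation with `s` gives `‖H s G‖² ≤ 2 D` in Hilbert-Schmidt norm. In
Fourier space `‖H s G‖²` weighs `|ŝ(p)|²` by the fraction of momenta `k` with `k` low and `k - p`
high, which is bounded below uniformly in `L` unless `p` is small (`exists_fraction`). Small `p` is
harmless because `s` takes only the values `±1`: the number of unlike neighbors of a site is `0` or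
at least `1`. So `D` controls the length of the domain wall (`sum_wall_le`), and also the number of
sites of low density (`IsDensityMatrix.card_low_mul_le`).

Passing from `(X, Y)` to `γ` costs a small multiple of the wall plus a constant times the removed
minority density (`trace_kinetic_restrict_le`). Large `U` pays for the latter where the majority
density is not small, and `D` pays elsewhere; this is `exists_functional_lower_bound`. A minimizer
therefore has no wall and no minority spin, so one of `X`, `Y` vanishes, and the other is the Fermi
sea if `μ` is off the spectrum. -/

namespace HFz

/-! ### Hilbert-Schmidt estimates for density matrices and projections -/

section Matrices

open Matrix
open scoped ComplexOrder

variable {n : Type*} [Fintype n]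

/-- The squared Hilbert-Schmidt norm. -/
noncomputable def hsSq (A : Matrix n n ℂ) : ℝ := ∑ x, ∑ y, ‖A x y‖ ^ 2

theorem hsSq_nonneg (A : Matrix n n ℂ) : 0 ≤ hsSq A :=
  Finset.sum_nonneg fun _ _ => Finset.sum_nonneg fun _ _ => sq_nonneg _

theorem eq_zero_of_hsSq_eq_zero {A : Matrix n n ℂ} (h : hsSq A = 0) : A = 0 := by
  ext x y
  have h1 := (Finset.sum_eq_zero_iff_of_nonneg fun x _ =>
    Finset.sum_nonneg fun y _ => sq_nonneg ‖A x y‖).1 h x (Finset.mem_univ x)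
  have h2 := (Finset.sum_eq_zero_iff_of_nonneg fun y _ => sq_nonneg ‖A x y‖).1 h1 y
    (Finset.mem_univ y)
  simpa using h2

theorem trace_conjTranspose_mul_self_re (A : Matrix n n ℂ) : (Aᴴ * A).trace.re = hsSq A := by
  simp only [Matrix.trace, Matrix.diag_apply, Matrix.mul_apply, Matrix.conjTranspose_apply,
    Complex.re_sum, hsSq]
  rw [Finset.sum_comm]
  refine Finset.sum_congr rfl fun x _ => Finset.sum_congr rfl fun y _ => ?_
  rw [Complex.star_def, ← Complex.normSq_eq_conj_mul_self, Complex.ofReal_re,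
    Complex.normSq_eq_norm_sq]

theorem hsSq_add_le (A B : Matrix n n ℂ) : hsSq (A + B) ≤ 2 * hsSq A + 2 * hsSq B := by
  simp only [hsSq, Finset.mul_sum, ← Finset.sum_add_distrib]
  refine Finset.sum_le_sum fun x _ => Finset.sum_le_sum fun y _ => ?_
  have h := norm_add_le (A x y) (B x y)
  have h0 := norm_nonneg (A x y + B x y)
  rw [Matrix.add_apply]
  nlinarith [sq_nonneg (‖A x y‖ - ‖B x y‖)]

theorem hsSq_conjTranspose (A : Matrix n n ℂ) : hsSq Aᴴ = hsSq A := by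
  simp only [hsSq, Matrix.conjTranspose_apply, norm_star]
  exact Finset.sum_comm

theorem PosSemidef.trace_re_nonneg {A : Matrix n n ℂ} (h : A.PosSemidef) : 0 ≤ A.trace.re :=
  (Complex.le_def.1 h.trace_nonneg).1

/-- This is nonnegativity of the principal `2 × 2` minor at `x, y`. -/
theorem PosSemidef.norm_apply_sq_le {n : Type*} {A : Matrix n n ℂ} (h : A.PosSemidef) (x y : n) :
    ‖A x y‖ ^ 2 ≤ (A x x).re * (A y y).re := by
  have h1 := (h.submatrix ![x, y]).det_nonneg
  rw [Matrix.det_fin_two] at h1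
  simp only [submatrix_apply, cons_val_zero, cons_val_one] at h1
  have h2 := (Complex.le_def.1 h1).1
  have e : A y x = star (A x y) := (h.isHermitian.apply x y).symm ▸ by simp
  have ex : (A x x).im = 0 := (Complex.le_def.1 (h.diag_nonneg (i := x))).2.symm
  rw [e, Complex.star_def, Complex.mul_conj, Complex.normSq_eq_norm_sq] at h2
  rw [Complex.zero_re, Complex.sub_re, Complex.ofReal_re, Complex.mul_re, ex, zero_mul,
    sub_zero] at h2
  linarith

theorem PosSemidef.diag_re_nonneg {n : Type*} {A : Matrix n n ℂ} (h : A.PosSemidef) (x : n) :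
    0 ≤ (A x x).re :=
  (Complex.le_def.1 (h.diag_nonneg (i := x))).1

theorem PosSemidef.eq_zero_of_diag {n : Type*} {A : Matrix n n ℂ} (h : A.PosSemidef)
    (h0 : ∀ x, (A x x).re = 0) : A = 0 := by
  ext x y
  have := PosSemidef.norm_apply_sq_le h x y
  rw [h0 x, zero_mul] at this
  have h2 : ‖A x y‖ = 0 := by nlinarith [norm_nonneg (A x y)]
  simpa using h2

theorem IsDensityMatrix.one_sub {n : Type*} [DecidableEq n] {γ : Matrix n n ℂ} (h : IsDensityMatrix γ) :
    IsDensityMatrix (1 - γ) :=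
  ⟨h.2, by simpa using h.1⟩

theorem IsDensityMatrix.diag_re_le_one {n : Type*} [DecidableEq n] {γ : Matrix n n ℂ} (h : IsDensityMatrix γ) (x : n) :
    (γ x x).re ≤ 1 := by
  have := PosSemidef.diag_re_nonneg h.2 x
  simp at this
  linarith

variable [DecidableEq n]

/-- Pythagoras for the splitting `A = H A + (1 - H) A`. -/
theorem hsSq_projection_mul_le {H : Matrix n n ℂ} (hH : H.IsHermitian) (hH2 : H * H = H)
    (A : Matrix n n ℂ) : hsSq (H * A) ≤ hsSq A := by
  have key : hsSq A = hsSq (H * A) + hsSq ((1 - H) * A) := by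
    rw [← trace_conjTranspose_mul_self_re, ← trace_conjTranspose_mul_self_re,
      ← trace_conjTranspose_mul_self_re, ← Complex.add_re, ← Matrix.trace_add]
    congr 2
    rw [conjTranspose_mul, conjTranspose_mul, conjTranspose_sub, hH.eq, conjTranspose_one]
    have e1 : Aᴴ * H * (H * A) = Aᴴ * H * A := by
      rw [mul_assoc, ← mul_assoc H H A, hH2, ← mul_assoc]
    have e2 : Aᴴ * (1 - H) * ((1 - H) * A) = Aᴴ * (1 - H) * A := by
      have : (1 - H) * (1 - H) = 1 - H := by
        rw [mul_sub, sub_mul, sub_mul, hH2]; simp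
      rw [mul_assoc, ← mul_assoc (1 - H) (1 - H) A, this, ← mul_assoc]
    rw [e1, e2, mul_sub, sub_mul]
    simp
  have := hsSq_nonneg ((1 - H) * A)
  linarith

theorem hsSq_diagonal_mul {s : n → ℂ} (hs : ∀ x, ‖s x‖ = 1) (A : Matrix n n ℂ) :
    hsSq (diagonal s * A) = hsSq A := by
  simp [hsSq, Matrix.diagonal_mul, hs]

/-- The identity `γ - γ² = γ (1 - γ) γ + (1 - γ) γ (1 - γ)` exhibits a sum of two congruences of
positive matrices, without any spectral theory. -/
theorem IsDensityMatrix.sub_mul_self {γ : Matrix n n ℂ} (h : IsDensityMatrix γ) :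
    (γ - γ * γ).PosSemidef := by
  have e : γ - γ * γ = γᴴ * (1 - γ) * γ + (1 - γ)ᴴ * γ * (1 - γ) := by
    rw [h.1.isHermitian.eq, h.2.isHermitian.eq]
    noncomm_ring
  rw [e]
  exact (h.2.conjTranspose_mul_mul_same γ).add (h.1.conjTranspose_mul_mul_same (1 - γ))

theorem IsDensityMatrix.hsSq_mul_projection_le {γ G : Matrix n n ℂ} (h : IsDensityMatrix γ)
    (hG : G.IsHermitian) (hG2 : G * G = G) : hsSq (γ * G) ≤ (G * γ).trace.re := by
  have h1 := PosSemidef.trace_re_nonneg (h.sub_mul_self.conjTranspose_mul_mul_same G)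
  have e : Gᴴ * (γ - γ * γ) * G = Gᴴ * γ * G - (γ * G)ᴴ * (γ * G) := by
    rw [conjTranspose_mul, h.1.isHermitian.eq]
    noncomm_ring
  rw [e, trace_sub, Complex.sub_re, trace_conjTranspose_mul_self_re, hG.eq, trace_mul_comm,
    ← mul_assoc, hG2] at h1
  linarith

/-- If a density matrix commutes with a diagonal phase, the phase nearly preserves the range of
`H` orthogonal to that of `G` as far as `H ≲ γ` and `G ≲ 1 - γ`. -/
theorem IsDensityMatrix.hsSq_mul_diagonal_mul_le {γ G H : Matrix n n ℂ} (h : IsDensityMatrix γ)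
    (hG : G.IsHermitian) (hG2 : G * G = G) (hH : H.IsHermitian) (hH2 : H * H = H)
    {s : n → ℂ} (hs : ∀ x, ‖s x‖ = 1) (hc : Commute γ (diagonal s)) :
    hsSq (H * diagonal s * G) ≤ 2 * ((G * γ).trace.re + (H * (1 - γ)).trace.re) := by
  -- Insert `γ + (1 - γ)` in the middle; commutation moves `γ` past the phase to stand next to `G`,
  -- while `1 - γ` stays next to `H`.
  have e : H * diagonal s * G
      = H * (diagonal s * (γ * G)) + (H * (1 - γ)) * (diagonal s * G) := by
    have := hc.eq
    calc H * diagonal s * G = H * (diagonal s * γ + (1 - γ) * diagonal s) * G := by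
          rw [← this]; noncomm_ring
      _ = _ := by noncomm_ring
  have h1 : hsSq (H * (diagonal s * (γ * G))) ≤ (G * γ).trace.re :=
    (hsSq_projection_mul_le hH hH2 _).trans
      ((hsSq_diagonal_mul hs _).le.trans (h.hsSq_mul_projection_le hG hG2))
  have h2 : hsSq ((H * (1 - γ)) * (diagonal s * G)) ≤ (H * (1 - γ)).trace.re := by
    rw [← hsSq_conjTranspose]
    simp only [conjTranspose_mul, diagonal_conjTranspose, hG.eq, hH.eq, h.2.isHermitian.eq]
    rw [mul_assoc]
    refine (hsSq_projection_mul_le hG hG2 _).trans ?_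
    rw [hsSq_diagonal_mul (by simpa using hs)]
    exact h.one_sub.hsSq_mul_projection_le hH hH2
  rw [e]
  have := hsSq_add_le (H * (diagonal s * (γ * G))) ((H * (1 - γ)) * (diagonal s * G))
  linarith

/-- Sites of low density are far from being filled. -/
theorem IsDensityMatrix.card_low_mul_le {γ H : Matrix n n ℂ} (h : IsDensityMatrix γ)
    (hH : H.IsHermitian) (hH2 : H * H = H) {a θ : ℝ} (ha : 0 ≤ a)  (hd : ∀ x, 2 * a ≤ (H x x).re) (hθ : θ ≤ a ^ 2) :
    ((Finset.univ.filter fun x => (γ x x).re < θ).card : ℝ) * a ^ 2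
      ≤ (H * (1 - γ)).trace.re := by
  classical
  refine le_trans ?_ (h.one_sub.hsSq_mul_projection_le hH hH2)
  have hHd : IsDensityMatrix H := by
    have e1 : H = Hᴴ * H := by rw [hH.eq, hH2]
    have e2 : 1 - H = (1 - H)ᴴ * (1 - H) := by
      rw [conjTranspose_sub, conjTranspose_one, hH.eq, mul_sub, sub_mul, sub_mul, hH2]; simp
    constructor
    · rw [e1]; exact posSemidef_conjTranspose_mul_self H
    · rw [e2]; exact posSemidef_conjTranspose_mul_self (1 - H)
  -- The diagonal of `B² ≤ B`.
  have row : ∀ {B : Matrix n n ℂ}, IsDensityMatrix B → ∀ x, ∑ y, ‖B x y‖ ^ 2 ≤ (B x x).re := by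
    intro B hB x
    have := PosSemidef.diag_re_nonneg hB.sub_mul_self x
    rw [Matrix.sub_apply, Complex.sub_re, mul_apply, Complex.re_sum] at this
    have e : ∀ y, (B x y * B y x).re = ‖B x y‖ ^ 2 := fun y => by
      rw [← hB.1.isHermitian.apply y x, Complex.star_def, Complex.mul_conj, Complex.ofReal_re,
        Complex.normSq_eq_norm_sq]
    simp only [e] at this
    linarith
  -- Cauchy-Schwarz and `row` bound `(γ H) x x` by `a` at a site of low density, while `H x x` is at
  -- least `2 a`.
  have hx : ∀ x, (γ x x).re < θ → a ^ 2 ≤ ‖((1 - γ) * H) x x‖ ^ 2 := by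
    intro x hlow
    have e : ((1 - γ) * H) x x = H x x - ∑ y, γ x y * H y x := by
      rw [sub_mul, one_mul, Matrix.sub_apply, mul_apply]
    have hcs : (‖∑ y, γ x y * H y x‖) ^ 2 ≤ a ^ 2 := by
      calc (‖∑ y, γ x y * H y x‖) ^ 2 ≤ (∑ y, ‖γ x y‖ * ‖H x y‖) ^ 2 := by
            gcongr
            refine (norm_sum_le _ _).trans (Finset.sum_le_sum fun y _ => ?_)
            rw [norm_mul, ← hH.apply y x, norm_star]
        _ ≤ (∑ y, ‖γ x y‖ ^ 2) * ∑ y, ‖H x y‖ ^ 2 := Finset.sum_mul_sq_le_sq_mul_sq _ _ _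
        _ ≤ a ^ 2 * 1 := by
            have h1 := row h x
            have h2 := row hHd x
            have h3 := hHd.diag_re_le_one x
            have h4 : 0 ≤ ∑ y, ‖H x y‖ ^ 2 := Finset.sum_nonneg fun _ _ => sq_nonneg _
            refine mul_le_mul (by linarith) (by linarith) h4 (sq_nonneg a)
        _ = a ^ 2 := mul_one _
    have hcs' := abs_le_of_sq_le_sq hcs ha
    rw [abs_norm] at hcs'
    have : a ≤ ‖((1 - γ) * H) x x‖ := by
      rw [e]
      have h1 := norm_sub_norm_le (H x x) (∑ y, γ x y * H y x)
      have h2 := Complex.re_le_norm (H x x)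
      have := hd x
      linarith
    gcongr
  calc ((Finset.univ.filter fun x => (γ x x).re < θ).card : ℝ) * a ^ 2
      = ∑ x ∈ Finset.univ.filter fun x => (γ x x).re < θ, a ^ 2 := by simp
    _ ≤ ∑ x ∈ Finset.univ.filter fun x => (γ x x).re < θ, ‖((1 - γ) * H) x x‖ ^ 2 :=
        Finset.sum_le_sum fun x hx' => hx x (by simpa using hx')
    _ ≤ ∑ x, ‖((1 - γ) * H) x x‖ ^ 2 :=
        Finset.sum_le_sum_of_subset_of_nonneg (Finset.subset_univ _) fun _ _ _ => sq_nonneg _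
    _ ≤ hsSq ((1 - γ) * H) := by
        refine Finset.sum_le_sum fun x _ => ?_
        exact Finset.single_le_sum (f := fun y => ‖((1 - γ) * H) x y‖ ^ 2)
          (fun _ _ => sq_nonneg _) (Finset.mem_univ x)

end Matrices

end HFz

namespace HFz

/-! ### Plane waves and Fourier multipliers on the torus -/

section Fourier

open Matrix
open scoped ComplexOrder

variable {d L : ℕ} [NeZero L]

/-- The plane wave of momentum `2πk/L`. -/
noncomputable def planeWave (k x : Lattice d L) : ℂ := ∏ ν, ZMod.stdAddChar (k ν * x ν)

theorem planeWave_comm (k x : Lattice d L) : planeWave k x = planeWave x k := by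
  simp only [planeWave, mul_comm]

theorem planeWave_add (k x y : Lattice d L) :
    planeWave k (x + y) = planeWave k x * planeWave k y := by
  simp only [planeWave, ← Finset.prod_mul_distrib, Pi.add_apply, mul_add, AddChar.map_add_eq_mul]

theorem planeWave_add_left (k p x : Lattice d L) :
    planeWave (k + p) x = planeWave k x * planeWave p x := by
  rw [planeWave_comm, planeWave_add, planeWave_comm x, planeWave_comm x]

@[simp]
theorem planeWave_zero (k : Lattice d L) : planeWave k 0 = 1 := by
  simp [planeWave]

theorem star_planeWave (k x : Lattice d L) : star (planeWave k x) = planeWave k (-x) := by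
  simp only [planeWave, star_prod, Pi.neg_apply, mul_neg, ZMod.stdAddChar_apply,
    AddChar.map_neg_eq_inv, Complex.star_def]
  refine Finset.prod_congr rfl fun ν _ => ?_
  rw [← Circle.coe_inv_eq_conj, Circle.coe_inv]

theorem planeWave_neg_left (k x : Lattice d L) : planeWave (-k) x = planeWave k (-x) := by
  simp [planeWave]

theorem sum_planeWave (x : Lattice d L) :
    ∑ k : Lattice d L, planeWave k x = if x = 0 then (Fintype.card (Lattice d L) : ℂ) else 0 := by
  have h : ∑ k : Lattice d L, planeWave k x = ∏ ν, ∑ j : ZMod L, ZMod.stdAddChar (j * x ν) := by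
    rw [Finset.prod_univ_sum, Fintype.piFinset_univ]
    rfl
  simp only [h, AddChar.sum_mulShift _ (ZMod.isPrimitive_stdAddChar L)]
  split_ifs with h0
  · simp [h0]
  · obtain ⟨ν, hν⟩ := Function.ne_iff.1 h0
    exact Finset.prod_eq_zero (Finset.mem_univ ν) (by rw [if_neg (by simpa using hν)]; simp)

theorem card_lattice_ne_zero : (Fintype.card (Lattice d L) : ℂ) ≠ 0 :=
  Nat.cast_ne_zero.2 Fintype.card_ne_zero

/-- The Fourier multiplier with symbol `m`. -/
noncomputable def multiplier (m : Lattice d L → ℝ) : Matrix (Lattice d L) (Lattice d L) ℂ :=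
  Matrix.of fun x y =>
    (Fintype.card (Lattice d L) : ℂ)⁻¹ * ∑ k, (m k : ℂ) * planeWave k (x - y)

theorem multiplier_apply (m : Lattice d L → ℝ) (x y : Lattice d L) :
    multiplier m x y = (Fintype.card (Lattice d L) : ℂ)⁻¹ * ∑ k, (m k : ℂ) * planeWave k (x - y) :=
  rfl

theorem multiplier_isHermitian (m : Lattice d L → ℝ) : (multiplier m).IsHermitian := by
  ext x y
  simp only [conjTranspose_apply, multiplier_apply, star_mul', star_sum, star_inv₀, star_natCast,
    star_planeWave, neg_sub]
  congr 1
  refine Finset.sum_congr rfl fun k _ => ?_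
  rw [Complex.star_def, Complex.conj_ofReal]

theorem multiplier_add (m m' : Lattice d L → ℝ) :
    multiplier (m + m') = multiplier m + multiplier m' := by
  ext x y
  simp [multiplier_apply, add_mul, Finset.sum_add_distrib, mul_add]

theorem multiplier_smul (c : ℝ) (m : Lattice d L → ℝ) :
    multiplier (c • m) = c • multiplier m := by
  ext x y
  rw [Matrix.smul_apply, multiplier_apply, multiplier_apply, Complex.real_smul, mul_left_comm,
    Finset.mul_sum (a := (c : ℂ))]
  simp [mul_assoc]

theorem multiplier_sub (m m' : Lattice d L → ℝ) :
    multiplier (m - m') = multiplier m - multiplier m' := by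
  ext x y
  simp [multiplier_apply, sub_mul, Finset.sum_sub_distrib, mul_sub]

theorem multiplier_one : multiplier (1 : Lattice d L → ℝ) = 1 := by
  ext x y
  simp only [multiplier_apply, Pi.one_apply, Complex.ofReal_one, one_mul, sum_planeWave,
    sub_eq_zero, Matrix.one_apply]
  split_ifs
  · exact inv_mul_cancel₀ card_lattice_ne_zero
  · simp

theorem multiplier_mulVec_planeWave (m : Lattice d L → ℝ) (q x : Lattice d L) :
    ∑ y, multiplier m x y * planeWave q y = m q * planeWave q x := by
  have h : ∀ k, ∑ y, planeWave k (x - y) * planeWave q y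
      = planeWave q x * if k = q then (Fintype.card (Lattice d L) : ℂ) else 0 := by
    intro k
    have h1 : ∑ y, planeWave y (q - k)
        = if q = k then (Fintype.card (Lattice d L) : ℂ) else 0 := by
      simp only [sum_planeWave, sub_eq_zero]
    have e : (if k = q then (Fintype.card (Lattice d L) : ℂ) else 0)
        = if q = k then (Fintype.card (Lattice d L) : ℂ) else 0 := by simp only [eq_comm]
    by_cases hkq : k = q
    · subst hkq
      rw [e, ← h1, Finset.mul_sum]
      refine Finset.sum_congr rfl fun y _ => ?_
      rw [← planeWave_add, sub_add_cancel]
      simp [planeWave]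
    · rw [if_neg hkq, mul_zero]
      have : ∀ y, planeWave k (x - y) * planeWave q y
          = planeWave k x * planeWave y (q - k) := by
        intro y
        rw [planeWave_comm y, sub_eq_add_neg q k, planeWave_add_left, planeWave_neg_left,
          sub_eq_add_neg x y, planeWave_add]
        ring
      simp only [this, ← Finset.mul_sum, h1, if_neg (Ne.symm hkq), mul_zero]
  simp only [multiplier_apply, Finset.mul_sum, Finset.sum_mul]
  rw [Finset.sum_comm]
  simp only [mul_assoc, ← Finset.mul_sum, h]
  simp only [mul_ite, mul_zero, Finset.sum_ite_eq', Finset.mem_univ, if_true]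
  have := card_lattice_ne_zero (d := d) (L := L)
  field_simp

theorem multiplier_mul (m m' : Lattice d L → ℝ) :
    multiplier (m * m') = multiplier m * multiplier m' := by
  ext x y
  rw [Matrix.mul_apply]
  have e : ∀ z, multiplier m x z * multiplier m' z y = (Fintype.card (Lattice d L) : ℂ)⁻¹ *
      ∑ k, (m' k : ℂ) * planeWave k (-y) * (multiplier m x z * planeWave k z) := by
    intro z
    rw [multiplier_apply m', mul_left_comm, Finset.mul_sum]
    congr 1
    refine Finset.sum_congr rfl fun k _ => ?_
    rw [sub_eq_add_neg, planeWave_add]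
    ring
  simp only [e, ← Finset.mul_sum]
  rw [Finset.sum_comm]
  simp only [← Finset.mul_sum, multiplier_mulVec_planeWave]
  rw [multiplier_apply]
  congr 1
  refine Finset.sum_congr rfl fun k _ => ?_
  rw [sub_eq_add_neg, planeWave_add]
  simp only [Pi.mul_apply, Complex.ofReal_mul]
  ring

/-- Fourier multipliers as an algebra homomorphism. -/
noncomputable def multiplierHom :
    (Lattice d L → ℝ) →ₐ[ℝ] Matrix (Lattice d L) (Lattice d L) ℂ :=
  AlgHom.ofLinearMap
    { toFun := multiplier, map_add' := multiplier_add, map_smul' := multiplier_smul }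
    multiplier_one multiplier_mul

theorem multiplier_diag (m : Lattice d L → ℝ) (x : Lattice d L) :
    multiplier m x x = (((Fintype.card (Lattice d L) : ℝ)⁻¹ * ∑ k, m k : ℝ) : ℂ) := by
  simp [multiplier_apply]

theorem trace_multiplier (m : Lattice d L → ℝ) : (multiplier m).trace = ((∑ k, m k : ℝ) : ℂ) := by
  have := card_lattice_ne_zero (d := d) (L := L)
  simp only [Matrix.trace, Matrix.diag_apply, multiplier_diag, Finset.sum_const, Finset.card_univ,
    nsmul_eq_mul]
  push_cast
  field_simp

/-- Only finitely many values of `f` matter, so `f` may be replaced by a polynomial, which passes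
through the algebra homomorphism `multiplierHom`. -/
theorem cfc_multiplier {m : Lattice d L → ℝ} {A : Matrix (Lattice d L) (Lattice d L) ℂ}
    (hA : A.IsHermitian) (hm : A = multiplier m) (f : ℝ → ℝ) :
    hA.cfc f = multiplier fun k => f (m k) := by
  classical
  -- Taking both sets as nodes avoids having to identify the eigenvalues with the values of the
  -- symbol.
  let s : Finset ℝ := Finset.univ.image hA.eigenvalues ∪ Finset.univ.image m
  let q := Lagrange.interpolate s id f
  have hq : ∀ t ∈ s, q.eval t = f t := fun t ht =>
    Lagrange.eval_interpolate_at_node (v := id) f Function.injective_id.injOn ht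
  rw [← hA.cfc_eq f]
  have h1 : cfc f A = cfc q.eval A := by
    refine cfc_congr fun t ht => (hq t ?_).symm
    obtain ⟨i, rfl⟩ := hA.spectrum_real_eq_range_eigenvalues ▸ ht
    simp [s]
  have hA' : IsSelfAdjoint A := hA
  rw [h1, cfc_polynomial q A hA', hm]
  change Polynomial.aeval (multiplierHom m) q = _
  rw [Polynomial.aeval_algHom_apply]
  change multiplier _ = _
  congr 1
  ext k
  rw [← hq (m k) (by simp [s])]
  have := Polynomial.aeval_algHom_apply (Pi.evalAlgHom ℝ (fun _ : Lattice d L => ℝ) k) m q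
  exact this.symm

theorem trace_cfc {n : Type*} [Fintype n] [DecidableEq n] {A : Matrix n n ℂ} (hA : A.IsHermitian)
    (f : ℝ → ℝ) : (hA.cfc f).trace = ((∑ i, f (hA.eigenvalues i) : ℝ) : ℂ) := by
  rw [Matrix.IsHermitian.cfc, Unitary.conjStarAlgAut_apply, trace_mul_comm, ← mul_assoc]
  simp [Matrix.trace]

/-- Plancherel for the unnormalized transform, whence the inverse volume. -/
theorem quadForm_multiplier (m : Lattice d L → ℝ) (s : Lattice d L → ℝ) :
    (∑ x, ∑ y, (s x : ℂ) * multiplier m x y * s y)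
      = (((Fintype.card (Lattice d L) : ℝ)⁻¹ *
          ∑ k, m k * ‖∑ x, (s x : ℂ) * planeWave k x‖ ^ 2 : ℝ) : ℂ) := by
  have h : ∀ k, ((‖∑ x, (s x : ℂ) * planeWave k x‖ ^ 2 : ℝ) : ℂ)
      = ∑ x, ∑ y, (s x : ℂ) * planeWave k (x - y) * s y := by
    intro k
    rw [← Complex.normSq_eq_norm_sq, Complex.normSq_eq_conj_mul_self, mul_comm, map_sum,
      Finset.sum_mul_sum]
    refine Finset.sum_congr rfl fun x _ => Finset.sum_congr rfl fun y _ => ?_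
    rw [map_mul, Complex.conj_ofReal, ← Complex.star_def, star_planeWave, sub_eq_add_neg,
      planeWave_add]
    ring
  push_cast [← Complex.ofReal_pow] at h ⊢
  simp only [h, multiplier_apply, Finset.mul_sum, Finset.sum_mul]
  rw [Finset.sum_comm_cycle]
  refine Finset.sum_congr rfl fun x _ => Finset.sum_congr rfl fun y _ =>
    Finset.sum_congr rfl fun k _ => ?_
  ring

/-- The symbol of `s ↦ ‖H s G‖²` as a quadratic form in the diagonal matrix `s`. -/
noncomputable def overlap (h g : Lattice d L → ℝ) (p : Lattice d L) : ℝ :=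
  (Fintype.card (Lattice d L) : ℝ)⁻¹ * ∑ k, h k * g (k - p)

/-- Entrywise products of kernels correspond to convolutions of symbols; the transposed second
factor turns the convolution into a correlation. -/
theorem multiplier_overlap_apply (h g : Lattice d L → ℝ) (x y : Lattice d L) :
    multiplier (overlap h g) x y = multiplier h x y * multiplier g y x := by
  simp only [multiplier_apply, overlap]
  push_cast
  simp only [Finset.mul_sum, Finset.sum_mul]
  rw [Finset.sum_comm]
  conv_rhs => rw [Finset.sum_comm]
  refine Finset.sum_congr rfl fun k _ => ?_
  rw [← (Equiv.subLeft k).sum_comp]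
  refine Finset.sum_congr rfl fun q _ => ?_
  have : planeWave (k - q) (x - y) = planeWave k (x - y) * planeWave q (y - x) := by
    rw [sub_eq_add_neg, planeWave_add_left, planeWave_neg_left, neg_sub]
  simp only [Equiv.subLeft_apply, sub_sub_cancel, this]
  ring

/-- By cyclicity and idempotence the norm is `Tr (h s h... )` with one factor of each projection
left, that is `∑ x y, s x * (h x y * g y x) * s y`, a quadratic form with translation invariant
kernel. -/
theorem hsSq_multiplier_diagonal_multiplier (h g : Lattice d L → ℝ) (hh : h * h = h)
    (hg : g * g = g) (s : Lattice d L → ℝ) :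
    hsSq (multiplier h * diagonal (fun x => (s x : ℂ)) * multiplier g)
      = (Fintype.card (Lattice d L) : ℝ)⁻¹ *
          ∑ k, overlap h g k * ‖∑ x, (s x : ℂ) * planeWave k x‖ ^ 2 := by
  have hs : (diagonal (fun x => (s x : ℂ)))ᴴ = diagonal fun x => (s x : ℂ) := by
    rw [diagonal_conjTranspose]
    congr 1
    ext x
    simp
  have e : (((Fintype.card (Lattice d L) : ℝ)⁻¹ *
      ∑ k, overlap h g k * ‖∑ x, (s x : ℂ) * planeWave k x‖ ^ 2 : ℝ) : ℂ)
      = ((multiplier h * diagonal (fun x => (s x : ℂ)) * multiplier g)ᴴ *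
        (multiplier h * diagonal (fun x => (s x : ℂ)) * multiplier g)).trace := by
    rw [← quadForm_multiplier]
    simp only [conjTranspose_mul, (multiplier_isHermitian _).eq, hs]
    have : multiplier g * (diagonal (fun x => (s x : ℂ)) * multiplier h) *
        (multiplier h * diagonal (fun x => (s x : ℂ)) * multiplier g)
        = multiplier g * (diagonal (fun x => (s x : ℂ)) * multiplier h *
          diagonal (fun x => (s x : ℂ)) * multiplier g) := by
      have : multiplier h * multiplier h = multiplier h := by rw [← multiplier_mul, hh]
      simp only [mul_assoc]
      rw [← mul_assoc (multiplier h) (multiplier h), this]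
    rw [this, trace_mul_comm, mul_assoc, ← multiplier_mul, hg]
    simp only [Matrix.trace, Matrix.diag_apply, Matrix.mul_apply (N := multiplier g),
      mul_diagonal, diagonal_mul, multiplier_overlap_apply]
    refine Finset.sum_congr rfl fun x _ => Finset.sum_congr rfl fun y _ => ?_
    ring
  rw [← trace_conjTranspose_mul_self_re, ← e, Complex.ofReal_re]

end Fourier

end HFz

namespace HFz

/-! ### Dispersion relation and nearest neighbors -/

section Adjacency

variable {d L : ℕ}

/-- The angle `2πj/L`. -/
noncomputable def angle (j : ZMod L) : ℝ := 2 * Real.pi * (j.val / L)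

/-- The eigenvalue of `-Δ` at momentum `κ ∈ ℝ^d`. -/
noncomputable def band (κ : Fin d → ℝ) : ℝ := ∑ ν, (2 - 2 * Real.cos (κ ν))

/-- The eigenvalue of `-Δ` at the lattice momentum `2πk/L`. -/
noncomputable def dispersion (k : Lattice d L) : ℝ := band fun ν => angle (k ν)

theorem dispersion_nonneg (k : Lattice d L) : 0 ≤ dispersion k :=
  Finset.sum_nonneg (s := Finset.univ) (f := fun ν => 2 - 2 * Real.cos (angle (k ν))) fun ν _ => by
    linarith [Real.cos_le_one (angle (k ν))]

theorem dispersion_le (k : Lattice d L) : dispersion k ≤ 4 * d := by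
  calc dispersion k = ∑ ν, (2 - 2 * Real.cos (angle (k ν))) := rfl
    _ ≤ ∑ _ν : Fin d, (4 : ℝ) := Finset.sum_le_sum fun ν _ => by linarith [Real.neg_one_le_cos (angle (k ν))]
    _ = 4 * d := by simp [mul_comm]

/-- The adjacency function of the lattice. -/
noncomputable def nn (x y : Lattice d L) : ℝ := if dist1 x y = 1 then 1 else 0

theorem nn_nonneg (x y : Lattice d L) : 0 ≤ nn x y := by
  unfold nn; split_ifs <;> norm_num

theorem nn_comm (x y : Lattice d L) : nn x y = nn y x := by
  rw [nn, dist1_comm, nn]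

theorem valMinAbs_one_natAbs (hL : 3 ≤ L) : (1 : ZMod L).valMinAbs.natAbs = 1 := by
  have := ZMod.valMinAbs_natCast_of_le_half (n := L) (a := 1) (by omega)
  simp at this
  simp [this]

theorem natAbs_sum_single (hL : 3 ≤ L) (ν : Fin d) {a : ZMod L} (ha : a = 1 ∨ a = -1) :
    ∑ ν', (Pi.single (M := fun _ : Fin d => ZMod L) ν a ν').valMinAbs.natAbs = 1 := by
  rw [Finset.sum_eq_single ν]
  · rw [Pi.single_eq_same]
    rcases ha with rfl | rfl
    · exact valMinAbs_one_natAbs hL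
    · rw [ZMod.natAbs_valMinAbs_neg]; exact valMinAbs_one_natAbs hL
  · intro ν' _ h
    simp [Pi.single_eq_of_ne h]
  · simp

theorem one_ne_neg_one (hL : 3 ≤ L) : (1 : ZMod L) ≠ -1 := by
  intro h
  have h2 : ((2 : ℕ) : ZMod L) = 0 := by
    push_cast
    linear_combination h
  rw [ZMod.natCast_eq_zero_iff] at h2
  exact absurd (Nat.le_of_dvd (by norm_num) h2) (by omega)

/-- The bound on `L` makes `1 ≠ -1` in `ZMod L`, so the two neighbors in each direction are distinct
and none is counted twice. -/
theorem nn_eq_sum (hL : 3 ≤ L) (x y : Lattice d L) :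
    nn x y = ∑ ν : Fin d, ((if x - y = Pi.single ν 1 then (1 : ℝ) else 0) +
      if x - y = Pi.single ν (-1) then 1 else 0) := by
  have : Fact (1 < L) := ⟨by omega⟩
  have hd : dist1 x y = ∑ ν, ((x - y) ν).valMinAbs.natAbs := rfl
  rw [nn, hd]
  generalize x - y = z
  split_ifs with h
  · obtain ⟨ν, hν, h0⟩ : ∃ ν, (z ν).valMinAbs.natAbs = 1 ∧ ∀ ν' ≠ ν, z ν' = 0 := by
      obtain ⟨ν, -, hν⟩ : ∃ ν ∈ Finset.univ, (z ν).valMinAbs.natAbs ≠ 0 :=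
        Finset.exists_ne_zero_of_sum_ne_zero (by rw [h]; exact one_ne_zero)
      have hsum := Finset.add_sum_erase Finset.univ (fun ν => (z ν).valMinAbs.natAbs)
        (Finset.mem_univ ν)
      simp only [h] at hsum
      refine ⟨ν, by omega, fun ν' hne => ?_⟩
      have h0 := Finset.sum_eq_zero_iff.1 (show ∑ ν' ∈ Finset.univ.erase ν,
        (z ν').valMinAbs.natAbs = 0 by omega) ν' (by simp [hne])
      simpa using h0
    have hz : z = Pi.single ν (z ν) := by
      ext ν'
      by_cases e : ν' = ν
      · subst e; simp
      · rw [h0 ν' e, Pi.single_eq_of_ne e]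
    have hz1 : z ν = 1 ∨ z ν = -1 := by
      rw [← ZMod.coe_valMinAbs (z ν)]
      rcases Int.natAbs_eq_iff.1 hν with e | e
      · left; rw [e]; simp
      · right; rw [e]; simp
    rw [Finset.sum_eq_single ν]
    · have hne := one_ne_neg_one hL
      rw [hz]
      simp only [Pi.single_inj]
      rcases hz1 with e | e
      · rw [e, if_pos rfl, if_neg hne, add_zero]
      · rw [e, if_pos rfl, if_neg hne.symm, zero_add]
    · intro ν' _ hne
      have hz2 : z ν' = 0 := h0 ν' hne
      rw [if_neg, if_neg, add_zero]
      · intro e; rw [e] at hz2; simp at hz2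
      · intro e; rw [e] at hz2; simp at hz2
    · simp
  · symm
    refine Finset.sum_eq_zero fun ν _ => ?_
    rw [if_neg, if_neg, add_zero]
    · rintro rfl; exact h (natAbs_sum_single hL ν (Or.inr rfl))
    · rintro rfl; exact h (natAbs_sum_single hL ν (Or.inl rfl))

theorem kinetic_apply (μ : ℝ) (x y : Lattice d L) :
    kinetic d L μ x y = ((2 * d - μ) * (if x = y then 1 else 0) - nn x y : ℝ) := by
  simp only [kinetic, laplacian, hopping, nn, Matrix.sub_apply, Matrix.neg_apply, Matrix.of_apply,
    Matrix.smul_apply, Matrix.one_apply, smul_eq_mul]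
  split_ifs <;> push_cast <;> ring

theorem wall_term {s : Lattice d L → ℝ} (hs : ∀ x, s x = 1 ∨ s x = -1) (x y : Lattice d L) :
    nn x y * ((1 - s x * s y) / 2) = 0 ∨ nn x y * ((1 - s x * s y) / 2) = 1 := by
  unfold nn
  rcases hs x with h | h <;> rcases hs y with h' | h' <;> rw [h, h'] <;> split_ifs <;> norm_num

end Adjacency

/-! ### Diagonalization of the Laplacian and connectedness of the torus -/

section Dispersion

variable {d L : ℕ} [NeZero L]

/-- On the unit circle the angle becomes a homomorphism, so the wrap-around in `ZMod.val` disappears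
from later addition formulas. -/
theorem cos_angle_add (j : ZMod L) (t : ℝ) :
    Real.cos (angle j + t) = ((ZMod.toCircle j : ℂ) * Complex.exp (t * Complex.I)).re := by
  rw [ZMod.toCircle_eq_circleExp, Circle.coe_exp, ← Complex.exp_add, ← add_mul,
    ← Complex.ofReal_add, Complex.exp_ofReal_mul_I_re, angle]

theorem cos_angle_sub (a b : ZMod L) :
    Real.cos (angle (a - b)) = Real.cos (angle a + -angle b) := by
  rw [cos_angle_add, ← add_zero (angle (a - b)), cos_angle_add, AddChar.map_sub_eq_div,
    ZMod.toCircle_eq_circleExp b, div_eq_mul_inv, ← Circle.exp_neg, Circle.coe_mul,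
    Circle.coe_exp, angle]
  simp

theorem cos_angle_intCast_add (a : ℤ) (t : ℝ) :
    Real.cos (angle (a : ZMod L) + t) = Real.cos (2 * Real.pi * a / L + t) := by
  rw [cos_angle_add, ZMod.toCircle_intCast, ← Complex.exp_add, ← Complex.exp_ofReal_mul_I_re]
  congr 2
  push_cast
  ring

theorem planeWave_single_add (k : Lattice d L) (ν : Fin d) :
    planeWave k (Pi.single ν 1) + planeWave k (-Pi.single ν 1)
      = 2 * (Real.cos (angle (k ν)) : ℂ) := by
  have h : planeWave k (Pi.single ν 1) = ZMod.toCircle (k ν) := by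
    rw [planeWave, Finset.prod_eq_single ν]
    · simp [ZMod.stdAddChar_apply]
    · intro ν' _ hν
      simp [Pi.single_eq_of_ne hν]
    · simp
  rw [← star_planeWave, h, Complex.star_def, Complex.add_conj, ← add_zero (angle (k ν)),
    cos_angle_add]
  simp

theorem sum_nn (hL : 3 ≤ L) (x : Lattice d L) : ∑ y, nn x y = 2 * d := by
  simp only [nn_eq_sum hL]
  refine ((Equiv.subLeft x).sum_comp (fun z => ∑ ν : Fin d,
    ((if z = Pi.single ν 1 then (1 : ℝ) else 0) +
      if z = Pi.single ν (-1) then 1 else 0))).trans ?_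
  rw [Finset.sum_comm]
  simp only [Finset.sum_add_distrib, Finset.sum_ite_eq', Finset.mem_univ, if_true, Finset.sum_const, Finset.card_univ,
    Fintype.card_fin, nsmul_eq_mul]
  ring

theorem multiplier_dispersion (hL : 3 ≤ L) :
    -laplacian d L = multiplier (dispersion (d := d) (L := L)) := by
  have hN := card_lattice_ne_zero (d := d) (L := L)
  ext x y
  have hdisp : ∀ k : Lattice d L, (dispersion k : ℂ) * planeWave k (x - y)
      = ∑ ν : Fin d, (2 * planeWave k (x - y) - (planeWave k (x - y - Pi.single ν (-1)) +
          planeWave k (x - y - Pi.single ν 1))) := by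
    intro k
    rw [dispersion, band]
    push_cast
    rw [Finset.sum_mul]
    refine Finset.sum_congr rfl fun ν _ => ?_
    rw [← Complex.ofReal_cos, ← planeWave_single_add, Pi.single_neg, sub_neg_eq_add,
      planeWave_add, sub_eq_add_neg _ (Pi.single ν 1), planeWave_add]
    ring
  have hnn : hopping d L x y = nn x y := by
    simp only [hopping, Matrix.of_apply, nn]
    split_ifs <;> simp
  rw [multiplier_apply]
  simp only [hdisp]
  rw [Finset.sum_comm]
  simp only [Finset.sum_sub_distrib, Finset.sum_add_distrib, ← Finset.mul_sum, sum_planeWave,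
    laplacian, Matrix.neg_apply, Matrix.sub_apply, hnn, nn_eq_sum hL, Matrix.smul_apply,
    Matrix.one_apply, sub_eq_zero]
  push_cast
  simp only [apply_ite Complex.ofReal, Complex.ofReal_one, Complex.ofReal_zero, mul_sub, mul_add, Finset.mul_sum, mul_ite, mul_zero,
    inv_mul_cancel₀ hN, Finset.sum_const, Finset.card_univ, Fintype.card_fin, nsmul_eq_mul,
    smul_eq_mul, mul_one]
  split_ifs
  · field_simp
    ring
  · ring

theorem kinetic_eq_multiplier (hL : 3 ≤ L) (μ : ℝ) :
    kinetic d L μ = multiplier fun k => dispersion k - μ := by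
  have e : (fun k : Lattice d L => dispersion k - μ) = dispersion - μ • 1 := by
    ext k; simp
  rw [kinetic, multiplier_dispersion hL, e, multiplier_sub, multiplier_smul, multiplier_one]
  rfl

theorem eq_of_forall_nn (hL : 3 ≤ L) {α : Type*} (f : Lattice d L → α)
    (h : ∀ x y, nn x y = 1 → f x = f y) (x y : Lattice d L) : f x = f y := by
  -- The periods of `f` form a subgroup; it contains the unit vectors, hence everything.
  let P : AddSubgroup (Lattice d L) :=
    { carrier := {a | ∀ z, f (z + a) = f z}
      zero_mem' := fun z => by rw [add_zero]
      add_mem' := fun {a b} ha hb z => by rw [← add_assoc, hb, ha]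
      neg_mem' := fun {a} ha z => by
        have := ha (z + -a)
        rw [neg_add_cancel_right] at this
        exact this.symm }
  have h1 : ∀ ν : Fin d, Pi.single ν (1 : ZMod L) ∈ P := fun ν z => by
    apply h
    rw [nn, if_pos]
    simpa [dist1] using natAbs_sum_single hL ν (a := 1) (Or.inl rfl)
  have h2 : ∀ a : Lattice d L, a ∈ P := fun a => by
    rw [← Finset.univ_sum_single a]
    refine sum_mem fun ν _ => ?_
    have : Pi.single ν (a ν) = (a ν).val • (Pi.single ν (1 : ZMod L) : Lattice d L) := by
      rw [← Pi.single_smul]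
      simp
    rw [this]
    exact nsmul_mem (h1 ν) _
  have := h2 (x - y) y
  rwa [add_sub_cancel] at this

end Dispersion

/-! ### Control of the domain wall -/

section DomainWall

open Matrix

variable {d L : ℕ} [NeZero L]

/-- The number of neighbors of `x` at which the sign `s` differs from `s x`. -/
noncomputable def wall (s : Lattice d L → ℝ) (x : Lattice d L) : ℝ :=
  ∑ y, nn x y * ((1 - s x * s y) / 2)

theorem wall_nonneg {s : Lattice d L → ℝ} (hs : ∀ x, s x = 1 ∨ s x = -1) (x : Lattice d L) :
    0 ≤ wall s x :=
  Finset.sum_nonneg fun y _ => by rcases wall_term hs x y with h | h <;> rw [h]; norm_num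

/-- Every summand is `0` or `1`, so the sum is `0` or at least `1`. This discreteness replaces
control of small momenta. -/
theorem wall_le_sq {s : Lattice d L → ℝ} (hs : ∀ x, s x = 1 ∨ s x = -1) (x : Lattice d L) :
    wall s x ≤ wall s x ^ 2 := by
  by_cases h : ∀ y, nn x y * ((1 - s x * s y) / 2) = 0
  · have : wall s x = 0 := Finset.sum_eq_zero fun y _ => h y
    rw [this]; norm_num
  · push Not at h
    obtain ⟨y, hy⟩ := h
    have h1 : 1 ≤ wall s x := by
      rw [← (wall_term hs x y).resolve_left hy]
      exact Finset.single_le_sum (f := fun y => nn x y * ((1 - s x * s y) / 2))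
        (fun y _ => by rcases wall_term hs x y with h | h <;> rw [h]; norm_num)
        (Finset.mem_univ y)
    nlinarith

theorem multiplier_dispersion_mulVec (hL : 3 ≤ L) {s : Lattice d L → ℝ}
    (hs : ∀ x, s x = 1 ∨ s x = -1) (x : Lattice d L) :
    ∑ y, multiplier dispersion x y * (s y : ℂ) = ((2 * s x * wall s x : ℝ) : ℂ) := by
  have h1 : ∀ y, multiplier dispersion x y * (s y : ℂ)
      = (((2 * d) * (if x = y then s y else 0) - nn x y * s y : ℝ) : ℂ) := by
    intro y
    have := kinetic_apply 0 x y
    rw [kinetic_eq_multiplier hL] at this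
    simp only [sub_zero] at this
    rw [this]
    split_ifs <;> push_cast <;> ring
  have hsq : s x * s x = 1 := by rcases hs x with h | h <;> rw [h] <;> norm_num
  simp only [h1]
  rw [← Complex.ofReal_sum]
  congr 1
  rw [Finset.sum_sub_distrib, ← Finset.mul_sum, Finset.sum_ite_eq, if_pos (Finset.mem_univ x),
    ← sum_nn hL x, wall, Finset.mul_sum, Finset.sum_mul, ← Finset.sum_sub_distrib]
  refine Finset.sum_congr rfl fun y _ => ?_
  linear_combination (nn x y * s y) * hsq

/-- Since `-Δ s = 2 s wall` and `s² = 1`, the symbols `ε` and `ε²` of `-Δ` and its square give `2 ∑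
wall` and `4 ∑ wall²`. Their difference is at least `2 ∑ wall`, although `ε² - ε` is negative at
small momenta; there `hov` only asks for a negative lower bound on the overlap. -/
theorem sum_wall_le (hL : 3 ≤ L) {s : Lattice d L → ℝ} (hs : ∀ x, s x = 1 ∨ s x = -1)
    {h g : Lattice d L → ℝ} (hh : h * h = h) (hg : g * g = g) {c : ℝ} (hc : 0 ≤ c)
    (hov : ∀ k, c * (dispersion k ^ 2 - dispersion k) ≤ overlap h g k) :
    2 * c * ∑ x, wall s x
      ≤ hsSq (multiplier h * diagonal (fun x => (s x : ℂ)) * multiplier g) := by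
  have hsq : ∀ x, s x * s x = 1 := fun x => by
    rcases hs x with h | h <;> rw [h] <;> norm_num
  have q1 : (Fintype.card (Lattice d L) : ℝ)⁻¹ *
      ∑ k, dispersion k * ‖∑ x, (s x : ℂ) * planeWave k x‖ ^ 2 = ∑ x, 2 * wall s x := by
    have := quadForm_multiplier dispersion s
    simp only [mul_assoc, ← Finset.mul_sum, multiplier_dispersion_mulVec hL hs] at this
    rw [← Complex.ofReal_inj, ← this]
    push_cast
    refine Finset.sum_congr rfl fun x _ => ?_
    have := congrArg (fun t : ℝ => (t : ℂ)) (hsq x)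
    push_cast at this
    linear_combination (2 * (wall s x : ℂ)) * this
  have q2 : (Fintype.card (Lattice d L) : ℝ)⁻¹ *
      ∑ k, dispersion k ^ 2 * ‖∑ x, (s x : ℂ) * planeWave k x‖ ^ 2
        = ∑ x, 4 * wall s x ^ 2 := by
    have e := quadForm_multiplier (dispersion * dispersion) s
    have sym : ∀ x z, multiplier (dispersion (d := d) (L := L)) x z = multiplier dispersion z x := by
      intro x z
      have h1 := kinetic_apply 0 x z
      have h2 := kinetic_apply 0 z x
      rw [kinetic_eq_multiplier hL] at h1 h2
      simp only [sub_zero] at h1 h2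
      rw [h1, h2, nn_comm z x]
      simp only [eq_comm]
    have e2 : ∑ x, ∑ y, (s x : ℂ) * multiplier (dispersion * dispersion) x y * s y
        = ∑ z, (∑ x, multiplier dispersion z x * (s x : ℂ)) *
          ∑ y, multiplier dispersion z y * (s y : ℂ) := by
      simp only [multiplier_mul, Matrix.mul_apply]
      calc _ = ∑ x, ∑ z, multiplier dispersion z x * (s x : ℂ) *
            ∑ y, multiplier dispersion z y * (s y : ℂ) := by
            refine Finset.sum_congr rfl fun x _ => ?_
            simp only [Finset.mul_sum, Finset.sum_mul]
            rw [Finset.sum_comm]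
            refine Finset.sum_congr rfl fun z _ => Finset.sum_congr rfl fun y _ => ?_
            rw [sym x z]
            ring
        _ = _ := by
            rw [Finset.sum_comm]
            simp only [Finset.sum_mul]
    rw [e2] at e
    simp only [multiplier_dispersion_mulVec hL hs] at e
    rw [← Complex.ofReal_inj]
    simp only [pow_two (dispersion _)]
    refine Eq.trans e.symm ?_
    push_cast
    refine Finset.sum_congr rfl fun x _ => ?_
    have := congrArg (fun t : ℝ => (t : ℂ)) (hsq x)
    push_cast at this
    linear_combination (4 * (wall s x : ℂ) ^ 2) * this
  rw [hsSq_multiplier_diagonal_multiplier h g hh hg]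
  calc 2 * c * ∑ x, wall s x ≤ c * (∑ x, 4 * wall s x ^ 2 - ∑ x, 2 * wall s x) := by
        rw [← Finset.sum_sub_distrib, mul_comm 2 c, mul_assoc, Finset.mul_sum]
        gcongr with x
        linarith [wall_le_sq hs x]
    _ = (Fintype.card (Lattice d L) : ℝ)⁻¹ * ∑ k, (c * (dispersion k ^ 2 - dispersion k)) *
          ‖∑ x, (s x : ℂ) * planeWave k x‖ ^ 2 := by
        rw [← q1, ← q2, ← mul_sub, ← Finset.sum_sub_distrib, mul_left_comm, Finset.mul_sum]
        congr 1
        refine Finset.sum_congr rfl fun k _ => ?_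
        ring
    _ ≤ _ := by
        gcongr with k
        exact hov k

end DomainWall

end HFz

namespace HFz

/-! ### Momentum shifts that cross the chemical potential -/

section Band

variable {d : ℕ}

/-- Both differences equal `2 sin (q/2)` times a sine, at `q/2` and at `a + q/2`; the latter lies
between `q/2` and `π - q/2`, where the sine is at least `sin (q/2)`. -/
theorem one_sub_cos_le_cos_sub_cos {a q : ℝ} (hq : 0 ≤ q) (ha : 0 ≤ a)
    (haq : a + q ≤ Real.pi) : 1 - Real.cos q ≤ Real.cos a - Real.cos (a + q) := by
  have h1 : 0 ≤ Real.sin (q / 2) := Real.sin_nonneg_of_nonneg_of_le_pi (by linarith) (by linarith)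
  have h2 : Real.sin (q / 2) ≤ Real.sin (a + q / 2) := by
    have h := Real.sin_sub_sin (a + q / 2) (q / 2)
    have h3 : 0 ≤ Real.sin ((a + q / 2 - q / 2) / 2) :=
      Real.sin_nonneg_of_nonneg_of_le_pi (by linarith) (by linarith)
    have h4 : 0 ≤ Real.cos ((a + q / 2 + q / 2) / 2) :=
      Real.cos_nonneg_of_mem_Icc ⟨by linarith, by linarith⟩
    nlinarith [mul_nonneg h3 h4]
  have e1 := Real.cos_sub_cos (a + q) a
  have e2 := Real.cos_sub_cos q 0
  rw [show (a + q + a) / 2 = a + q / 2 by ring, show (a + q - a) / 2 = q / 2 by ring] at e1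
  rw [Real.cos_zero, add_zero, sub_zero] at e2
  nlinarith [mul_le_mul_of_nonneg_right h2 h1]

/-- Move `κ` from `0`, the band bottom, to `π - q`, where `κ + q` is at the band top. The energies
of `κ` and `κ + q` stay at least `1` apart, so when their mean crosses `μ` each is at distance at
least `1/2` from it. If the mean never crosses, an endpoint works. -/
theorem exists_band_gap_of_mem_Icc {μ η : ℝ} (hη : η ≤ 1 / 2) (hημ : η ≤ μ) (hηd : η ≤ 4 * d - μ)
    {q : Fin d → ℝ} (hq0 : ∀ ν, 0 ≤ q ν) (hqπ : ∀ ν, q ν ≤ Real.pi) (hq : 1 ≤ band q) :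
    ∃ κ : Fin d → ℝ, band κ ≤ μ - η ∧ μ + η ≤ band (κ + q) := by
  let κ : ℝ → Fin d → ℝ := fun t ν => t * (Real.pi - q ν)
  have hgap : ∀ t ∈ Set.Icc (0 : ℝ) 1, band (κ t) + 1 ≤ band (κ t + q) := by
    intro t ht
    have : band q ≤ band (κ t + q) - band (κ t) := by
      rw [band, band, band, ← Finset.sum_sub_distrib]
      refine Finset.sum_le_sum fun ν _ => ?_
      have h0 : 0 ≤ Real.pi - q ν := by linarith [hqπ ν]
      have := one_sub_cos_le_cos_sub_cos (a := κ t ν) (hq0 ν) (mul_nonneg ht.1 h0)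
        (by have := mul_le_mul_of_nonneg_right ht.2 h0; simp only [κ]; linarith)
      simp only [Pi.add_apply]
      linarith
    linarith
  let F : ℝ → ℝ := fun t => (band (κ t) + band (κ t + q)) / 2
  have hF : Continuous F := by
    simp only [F, band, κ, Pi.add_apply]
    fun_prop
  by_cases h0 : μ ≤ F 0
  · refine ⟨κ 0, ?_⟩
    have e : band (κ 0) = 0 := by simp [band, κ]
    simp only [F, e] at h0
    rw [e]
    constructor <;> linarith
  by_cases h1 : F 1 ≤ μ
  · refine ⟨κ 1, ?_⟩
    have e : band (κ 1 + q) = 4 * d := by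
      simp [band, κ]
      ring
    simp only [F, e] at h1
    rw [e]
    constructor <;> linarith
  obtain ⟨t, ht, hFt⟩ := intermediate_value_Icc (zero_le_one' ℝ) hF.continuousOn
    ⟨(not_le.1 h0).le, (not_le.1 h1).le⟩
  have := hgap t ht
  simp only [F] at hFt
  exact ⟨κ t, by linarith, by linarith⟩

/-- The band is even and periodic in each coordinate, so `q` folds into `[0, π]`; where folding
reflects `q ν`, the component `κ ν` is reflected too. -/
theorem exists_band_gap {μ η : ℝ} (hη : η ≤ 1 / 2) (hημ : η ≤ μ) (hηd : η ≤ 4 * d - μ)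
    {q : Fin d → ℝ} (hq : 1 ≤ band q) :
    ∃ κ : Fin d → ℝ, band κ ≤ μ - η ∧ μ + η ≤ band (κ + q) := by
  let q' : Fin d → ℝ := fun ν => Real.arccos (Real.cos (q ν))
  have hcos : ∀ ν, Real.cos (q' ν) = Real.cos (q ν) := fun ν =>
    Real.cos_arccos (Real.neg_one_le_cos _) (Real.cos_le_one _)
  have hq' : band q' = band q := by simp only [band, hcos]
  obtain ⟨κ', h1, h2⟩ := exists_band_gap_of_mem_Icc hη hημ hηd (q := q')
    (fun ν => Real.arccos_nonneg _) (fun ν => Real.arccos_le_pi _) (hq'.symm ▸ hq)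
  have hex : ∀ ν, ∃ a, Real.cos a = Real.cos (κ' ν) ∧
      Real.cos (a + q ν) = Real.cos (κ' ν + q' ν) := by
    intro ν
    obtain ⟨m, hm | hm⟩ := Real.cos_eq_cos_iff.1 (hcos ν)
    · refine ⟨κ' ν, rfl, ?_⟩
      rw [hm, show κ' ν + (2 * m * Real.pi + q' ν) = (κ' ν + q' ν) + m * (2 * Real.pi) by ring,
        Real.cos_add_int_mul_two_pi]
    · refine ⟨-κ' ν, Real.cos_neg _, ?_⟩
      rw [hm, show -κ' ν + (2 * m * Real.pi - q' ν) = -(κ' ν + q' ν) + m * (2 * Real.pi) by ring,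
        Real.cos_add_int_mul_two_pi, Real.cos_neg]
  choose κ hκ1 hκ2 using hex
  refine ⟨κ, ?_, ?_⟩
  · simpa only [band, hκ1] using h1
  · simpa only [band, Pi.add_apply, hκ2] using h2

end Band

/-! ### Counting lattice momenta uniformly in the volume -/

section Counting

variable {d L : ℕ} [NeZero L]

/-- The lattice angles in an arc of length `r` starting at `κ`. The arc contains about `r L / (2π)`
of them, and the lower bound on `L` ensures that rounding loses at most half. -/
theorem exists_finset_angle_near {r : ℝ} (hr : 0 < r) (hrπ : r ≤ Real.pi)
    (hL : 4 * Real.pi / r ≤ L) (κ : ℝ) :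
    ∃ S : Finset (ZMod L), r / (4 * Real.pi) * L ≤ S.card ∧
      ∀ j ∈ S, ∀ t, |Real.cos (angle j + t) - Real.cos (κ + t)| ≤ r := by
  have hπ := Real.pi_pos
  have hL0 : (0 : ℝ) < L := Nat.cast_pos.2 (NeZero.pos L)
  let M := ⌊r * L / (2 * Real.pi)⌋₊
  let a := ⌈κ * L / (2 * Real.pi)⌉
  have hM : (M : ℝ) ≤ r * L / (2 * Real.pi) := Nat.floor_le (by positivity)
  have hML : M ≤ L := by
    have : r * L / (2 * Real.pi) ≤ L := by
      rw [div_le_iff₀ (by positivity)]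
      nlinarith
    exact_mod_cast hM.trans this
  refine ⟨(Finset.range M).image fun i : ℕ => ((a + i : ℤ) : ZMod L), ?_, ?_⟩
  · rw [Finset.card_image_of_injOn, Finset.card_range]
    · have h1 := Nat.lt_floor_add_one (r * L / (2 * Real.pi))
      have h2 : 1 ≤ r / (4 * Real.pi) * L := by
        rw [div_le_iff₀ hr] at hL
        rw [div_mul_eq_mul_div, le_div_iff₀ (by positivity)]
        linarith
      have h3 : r * L / (2 * Real.pi) = 2 * (r / (4 * Real.pi) * L) := by
        field_simp
        ring
      have h4 : r * L / (2 * Real.pi) < M + 1 := h1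
      linarith
    · intro i hi j hj hij
      simp only [Int.cast_add, Int.cast_natCast, add_right_inj] at hij
      rw [ZMod.natCast_eq_natCast_iff'] at hij
      simp only [Finset.coe_range, Set.mem_Iio] at hi hj
      rwa [Nat.mod_eq_of_lt (by omega), Nat.mod_eq_of_lt (by omega)] at hij
  · intro j hj t
    obtain ⟨i, hi, rfl⟩ := Finset.mem_image.1 hj
    rw [cos_angle_intCast_add]
    refine (Real.abs_cos_sub_cos_le _ _).trans ?_
    have hi' : (i : ℝ) + 1 ≤ M := by exact_mod_cast Finset.mem_range.1 hi
    have ha1 : κ * L / (2 * Real.pi) ≤ a := Int.le_ceil _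
    have ha2 : (a : ℝ) < κ * L / (2 * Real.pi) + 1 := Int.ceil_lt_add_one _
    have e : 2 * Real.pi * ((a + i : ℤ) : ℝ) / L + t - (κ + t)
        = 2 * Real.pi / L * ((a - κ * L / (2 * Real.pi)) + i) := by
      push_cast
      field_simp
      ring
    rw [e, abs_of_nonneg (mul_nonneg (by positivity) (add_nonneg (by linarith) (by positivity)))]
    calc 2 * Real.pi / L * ((a - κ * L / (2 * Real.pi)) + i)
        ≤ 2 * Real.pi / L * (r * L / (2 * Real.pi)) := by gcongr; linarith
      _ = r := by field_simp

theorem exists_finset_momentum_near {r : ℝ} (hr : 0 < r) (hrπ : r ≤ Real.pi)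
    (hL : 4 * Real.pi / r ≤ L) (κ : Fin d → ℝ) :
    ∃ S : Finset (Lattice d L), (r / (4 * Real.pi)) ^ d * Fintype.card (Lattice d L) ≤ S.card ∧
      ∀ k ∈ S, ∀ t : Fin d → ℝ,
        |band ((fun ν => angle (k ν)) + t) - band (κ + t)| ≤ 2 * d * r := by
  choose S hS hS' using fun ν => exists_finset_angle_near (L := L) hr hrπ hL (κ ν)
  refine ⟨Fintype.piFinset S, ?_, ?_⟩
  · have hπ := Real.pi_pos
    rw [Fintype.card_piFinset, Fintype.card_fun, ZMod.card, Fintype.card_fin]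
    push_cast
    rw [← mul_pow]
    calc (r / (4 * Real.pi) * L) ^ d = ∏ _ν : Fin d, (r / (4 * Real.pi) * L) := by simp
      _ ≤ _ := Finset.prod_le_prod (fun _ _ => by positivity) fun ν _ => hS ν
  · intro k hk t
    rw [band, band, ← Finset.sum_sub_distrib]
    refine (Finset.abs_sum_le_sum_abs _ _).trans ?_
    calc _ ≤ ∑ _ν : Fin d, 2 * r := Finset.sum_le_sum fun ν _ => by
            have := hS' ν (k ν) (Fintype.mem_piFinset.1 hk ν) (t ν)
            simp only [Pi.add_apply]
            rw [abs_le] at this ⊢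
            constructor <;> linarith
      _ = 2 * d * r := by simp; ring

/-- The indicator of the momenta of energy at most `e`. -/
noncomputable def lowSymbol (e : ℝ) (k : Lattice d L) : ℝ := if dispersion k ≤ e then 1 else 0

/-- The indicator of the momenta of energy at least `e`. -/
noncomputable def highSymbol (e : ℝ) (k : Lattice d L) : ℝ := if e ≤ dispersion k then 1 else 0

theorem dispersion_sub (k p : Lattice d L) :
    dispersion (k - p) = band ((fun ν => angle (k ν)) + fun ν => -angle (p ν)) := by
  simp only [dispersion, band, Pi.sub_apply, Pi.add_apply, cos_angle_sub]

/-- Uniformly in the volume, a positive fraction of momenta `k` lies well below the chemical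
potential, also when `k - p` is required to lie well above it and `p` is not small. -/
theorem exists_fraction {μ : ℝ} (hμ : 0 < μ) (hμd : μ < 4 * d) :
    ∃ η c : ℝ, 0 < η ∧ 0 < c ∧ ∃ L₀ : ℕ, ∀ (L : ℕ) [NeZero L], L₀ ≤ L →
      (∀ p : Lattice d L, 1 ≤ dispersion p →
        c ≤ overlap (lowSymbol (μ - η)) (highSymbol (μ + η)) p) ∧
      c ≤ (Fintype.card (Lattice d L) : ℝ)⁻¹ * ∑ k : Lattice d L, lowSymbol (μ - η) k := by
  have hd : (0 : ℝ) < d := by linarith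
  obtain ⟨η₀, h0, hη, hημ, hηd⟩ : ∃ η₀ : ℝ, 0 < η₀ ∧ η₀ ≤ 1 / 2 ∧ η₀ ≤ μ ∧ η₀ ≤ 4 * d - μ :=
    ⟨min (1 / 2) (min μ (4 * d - μ)), by simp [hμ, hμd], min_le_left _ _,
      (min_le_right _ _).trans (min_le_left _ _), (min_le_right _ _).trans (min_le_right _ _)⟩
  have hπ := Real.pi_pos
  have hd1 : (1 : ℝ) ≤ d := by
    have : 0 < d := by exact_mod_cast hd
    exact_mod_cast this
  -- With this radius the energies vary by at most `η₀ / 2`, which leaves half of the gap.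
  let r := η₀ / (4 * d)
  have hr : 0 < r := by positivity
  have hr2 : 2 * d * r = η₀ / 2 := by simp only [r]; field_simp; norm_num
  have hrπ : r ≤ Real.pi := by
    have : r ≤ η₀ := div_le_self h0.le (by linarith)
    linarith [Real.pi_gt_three]
  refine ⟨η₀ / 2, (r / (4 * Real.pi)) ^ d, by positivity, by positivity, ⌈4 * Real.pi / r⌉₊, ?_⟩
  intro L _ hL
  have hL' : 4 * Real.pi / r ≤ L := (Nat.le_ceil _).trans (by exact_mod_cast hL)
  have hN : (0 : ℝ) < Fintype.card (Lattice d L) := Nat.cast_pos.2 Fintype.card_pos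
  have key : ∀ (f : Lattice d L → ℝ) (S : Finset (Lattice d L)), (∀ k, 0 ≤ f k) →
      (r / (4 * Real.pi)) ^ d * Fintype.card (Lattice d L) ≤ S.card → (∀ k ∈ S, f k = 1) →
      (r / (4 * Real.pi)) ^ d ≤ (Fintype.card (Lattice d L) : ℝ)⁻¹ * ∑ k, f k := by
    intro f S hf hS h1
    rw [le_inv_mul_iff₀ hN, mul_comm]
    refine hS.trans ?_
    calc (S.card : ℝ) = ∑ k ∈ S, f k := by rw [Finset.sum_congr rfl h1]; simp
      _ ≤ ∑ k, f k := Finset.sum_le_sum_of_subset_of_nonneg (Finset.subset_univ _) fun k _ _ => hf k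
  constructor
  · intro p hp
    have hq : 1 ≤ band fun ν => -angle (p ν) := by
      simpa only [dispersion, band, Real.cos_neg] using hp
    obtain ⟨κ, h1, h2⟩ := exists_band_gap hη hημ hηd hq
    obtain ⟨S, hS, hS'⟩ := exists_finset_momentum_near hr hrπ hL' κ
    refine key _ S (fun k => ?_) hS fun k hk => ?_
    · unfold lowSymbol highSymbol
      split_ifs <;> norm_num
    · have e1 := hS' k hk 0
      have e2 := hS' k hk fun ν => -angle (p ν)
      rw [add_zero, add_zero, hr2, abs_le] at e1
      rw [hr2, abs_le, ← dispersion_sub] at e2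
      have e1' : dispersion k - band κ ≤ η₀ / 2 := e1.2
      rw [lowSymbol, if_pos (by linarith), highSymbol, if_pos (by linarith), one_mul]
  · obtain ⟨S, hS, hS'⟩ := exists_finset_momentum_near hr hrπ hL' (0 : Fin d → ℝ)
    refine key _ S (fun k => ?_) hS fun k hk => ?_
    · unfold lowSymbol
      split_ifs <;> norm_num
    · have e1 := hS' k hk 0
      have e0 : band (0 : Fin d → ℝ) = 0 := by simp [band]
      rw [add_zero, add_zero, hr2, e0, abs_le] at e1
      have e1' : dispersion k - 0 ≤ η₀ / 2 := e1.2
      rw [lowSymbol, if_pos (by linarith)]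

end Counting

end HFz

namespace HFz

/-! ### Gluing the two spin components and the coercive energy bound -/

section Energy

open Matrix
open scoped ComplexOrder

variable {d L : ℕ}

/-- The sign of the local magnetization. -/
noncomputable def spinSign (X Y : Matrix (Lattice d L) (Lattice d L) ℂ) (x : Lattice d L) : ℝ :=
  if (Y x x).re ≤ (X x x).re then 1 else -1

theorem spinSign_eq (X Y : Matrix (Lattice d L) (Lattice d L) ℂ) (x : Lattice d L) :
    spinSign X Y x = 1 ∨ spinSign X Y x = -1 := by
  unfold spinSign; split_ifs <;> simp

/-- Gluing along the sign of the magnetization discards exactly the minority density at each site.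
-/
theorem removed_spinSign (X Y : Matrix (Lattice d L) (Lattice d L) ℂ) (x : Lattice d L) :
    (1 - spinSign X Y x) / 2 * (X x x).re + (1 - -spinSign X Y x) / 2 * (Y x x).re
      = min (X x x).re (Y x x).re := by
  rw [spinSign]
  split_ifs with h
  · rw [min_eq_right h]; ring
  · rw [min_eq_left (not_le.1 h).le]; ring

variable [NeZero L]

theorem trace_multiplier_mul_nonneg {m : Lattice d L → ℝ} (hm : ∀ k, 0 ≤ m k)
    {γ : Matrix (Lattice d L) (Lattice d L) ℂ} (hγ : γ.PosSemidef) :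
    0 ≤ (multiplier m * γ).trace.re := by
  have e : m = (fun k => √(m k)) * fun k => √(m k) := by
    ext k
    exact (Real.mul_self_sqrt (hm k)).symm
  rw [e, multiplier_mul, mul_assoc, trace_mul_comm]
  have := hγ.conjTranspose_mul_mul_same (multiplier fun k => √(m k))
  rw [(multiplier_isHermitian _).eq] at this
  exact PosSemidef.trace_re_nonneg this

/-- With `w₊`, `w₋` the positive and negative parts, `Tr (w γ) = -Tr w₋ + Tr (w₊ γ) + Tr (w₋ (1 -
γ))`; then `w₊ ≥ η g` and `w₋ ≥ η h`. -/
theorem le_trace_multiplier_mul {w h g : Lattice d L → ℝ} {η : ℝ}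
    (hh : ∀ k, η * h k ≤ max (-w k) 0) (hg : ∀ k, η * g k ≤ max (w k) 0)
    {γ : Matrix (Lattice d L) (Lattice d L) ℂ} (hγ : IsDensityMatrix γ) :
    ∑ k, min (w k) 0 + η * ((multiplier g * γ).trace.re + (multiplier h * (1 - γ)).trace.re)
      ≤ (multiplier w * γ).trace.re := by
  have h1 := trace_multiplier_mul_nonneg (m := fun k => max (-w k) 0 - η * h k)
    (fun k => sub_nonneg.2 (hh k)) hγ.2
  have h2 := trace_multiplier_mul_nonneg (m := fun k => max (w k) 0 - η * g k)
    (fun k => sub_nonneg.2 (hg k)) hγ.1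
  have e1 : (fun k => max (-w k) 0 - η * h k) = (fun k => max (-w k) 0) - η • h := rfl
  have e2 : (fun k => max (w k) 0 - η * g k) = (fun k => max (w k) 0) - η • g := rfl
  have e3 : w = (fun k => max (w k) 0) - fun k => max (-w k) 0 := by
    ext k
    exact (max_zero_sub_eq_self (w k)).symm
  have e4 : ∑ k, min (w k) 0 = -(multiplier fun k => max (-w k) 0).trace.re := by
    rw [trace_multiplier, Complex.ofReal_re, ← Finset.sum_neg_distrib]
    refine Finset.sum_congr rfl fun k _ => ?_
    rw [← min_neg_neg]
    simp
  rw [e1, multiplier_sub, multiplier_smul] at h1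
  rw [e2, multiplier_sub, multiplier_smul] at h2
  rw [e4]
  conv_rhs => rw [e3, multiplier_sub]
  simp only [sub_mul, mul_sub, mul_one, smul_mul_assoc, trace_sub, trace_smul, Complex.sub_re,
    Complex.smul_re, smul_eq_mul] at h1 h2 ⊢
  linarith

theorem trace_kinetic_mul_re (μ : ℝ) (γ : Matrix (Lattice d L) (Lattice d L) ℂ) :
    (kinetic d L μ * γ).trace.re
      = ∑ x, (2 * d - μ) * (γ x x).re - ∑ x, ∑ y, nn x y * (γ y x).re := by
  simp only [Matrix.trace, Matrix.diag_apply, Matrix.mul_apply, Complex.re_sum, kinetic_apply,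
    Complex.re_ofReal_mul, sub_mul, Finset.sum_sub_distrib]
  simp

/-- Restricting a density matrix to the sites where `s = 1` costs at most a small multiple of the
length of the wall, plus a multiple of the number of particles that are removed. -/
theorem trace_kinetic_restrict_le {μ : ℝ} (hμd : μ < 4 * d) (hL : 3 ≤ L)
    {X : Matrix (Lattice d L) (Lattice d L) ℂ} (hX : IsDensityMatrix X) {s : Lattice d L → ℝ}
    (hs : ∀ x, s x = 1 ∨ s x = -1) {ε : ℝ} (hε : 0 < ε) (hε1 : ε ≤ 1) :
    (kinetic d L μ * (diagonal (fun x => (((1 + s x) / 2 : ℝ) : ℂ)) * X *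
        diagonal fun x => (((1 + s x) / 2 : ℝ) : ℂ))).trace.re
      ≤ (kinetic d L μ * X).trace.re + ε / 2 * ∑ x, wall s x
        + 2 * d * (1 + 1 / ε) * ∑ x, (1 - s x) / 2 * (X x x).re := by
  set ρ : Lattice d L → ℝ := fun x => (X x x).re with hρ
  have hρ0 : ∀ x, 0 ≤ ρ x := fun x => PosSemidef.diag_re_nonneg hX.1 x
  have hρ1 : ∀ x, ρ x ≤ 1 := fun x => hX.diag_re_le_one x
  have entry : ∀ x y, ((diagonal (fun x => (((1 + s x) / 2 : ℝ) : ℂ)) * X *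
        diagonal fun x => (((1 + s x) / 2 : ℝ) : ℂ)) y x).re
      = (1 + s x) / 2 * ((1 + s y) / 2) * (X y x).re := by
    intro x y
    rw [mul_diagonal, diagonal_mul, mul_comm, ← mul_assoc, ← Complex.ofReal_mul,
      Complex.re_ofReal_mul]
  -- A kept edge costs nothing. Across the wall, `|X y x|²` is at most the density at the removed
  -- endpoint, and the weighted arithmetic-geometric inequality applies. With both endpoints removed
  -- the unweighted one and `ε ≤ 1` suffice.
  have pt : ∀ x y, (1 - (1 + s x) / 2 * ((1 + s y) / 2)) * (X y x).re
      ≤ ε / 2 * ((1 - s x * s y) / 2)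
        + 1 / (2 * ε) * ((1 - s x) / 2 * ρ x + (1 - s y) / 2 * ρ y) := by
    intro x y
    have h1 := PosSemidef.norm_apply_sq_le hX.1 y x
    have h2 := Complex.re_le_norm (X y x)
    have h0 := norm_nonneg (X y x)
    change _ ≤ ρ y * ρ x at h1
    have cross : ∀ z, ‖X y x‖ ^ 2 ≤ ρ z → ‖X y x‖ ≤ ε / 2 + 1 / (2 * ε) * ρ z := by
      intro z hz
      have : ε / 2 + 1 / (2 * ε) * ρ z = (ε ^ 2 + ρ z) / (2 * ε) := by field_simp
      rw [this, le_div_iff₀ (by positivity)]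
      nlinarith [sq_nonneg (ε - ‖X y x‖)]
    rcases hs x with hx | hx <;> rcases hs y with hy | hy <;> rw [hx, hy]
    · norm_num
    · have := cross y (h1.trans (mul_le_of_le_one_right (hρ0 y) (hρ1 x)))
      norm_num at this ⊢
      linarith
    · have := cross x (h1.trans (mul_le_of_le_one_left (hρ0 x) (hρ1 y)))
      norm_num at this ⊢
      linarith
    · have h3 : 2 * ‖X y x‖ ≤ ρ x + ρ y := by
        refine abs_le_of_sq_le_sq' ?_ (add_nonneg (hρ0 x) (hρ0 y)) |>.2
        nlinarith [sq_nonneg (ρ x - ρ y)]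
      have h4 : ‖X y x‖ ≤ 1 / (2 * ε) * (ρ x + ρ y) := by
        rw [one_div_mul_eq_div, le_div_iff₀ (by positivity)]
        nlinarith
      norm_num at h4 ⊢
      linarith
  have hsum : ∑ x, ∑ y, nn x y * (X y x).re
      - ∑ x, ∑ y, nn x y * ((1 + s x) / 2 * ((1 + s y) / 2) * (X y x).re)
      ≤ ε / 2 * ∑ x, wall s x + 2 * d / ε * ∑ x, (1 - s x) / 2 * ρ x := by
    have e1 : ∑ x, ∑ y, nn x y * ((1 - s x) / 2 * ρ x) = 2 * d * ∑ x, (1 - s x) / 2 * ρ x := by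
      simp only [← Finset.sum_mul, sum_nn hL, Finset.mul_sum]
    have e2 : ∑ x, ∑ y, nn x y * ((1 - s y) / 2 * ρ y) = 2 * d * ∑ x, (1 - s x) / 2 * ρ x := by
      rw [Finset.sum_comm, ← e1]
      simp only [nn_comm]
    calc _ = ∑ x, ∑ y, nn x y * ((1 - (1 + s x) / 2 * ((1 + s y) / 2)) * (X y x).re) := by
          simp only [← Finset.sum_sub_distrib]
          refine Finset.sum_congr rfl fun x _ => Finset.sum_congr rfl fun y _ => ?_
          ring
      _ ≤ ∑ x, ∑ y, nn x y * (ε / 2 * ((1 - s x * s y) / 2)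
        + 1 / (2 * ε) * ((1 - s x) / 2 * ρ x + (1 - s y) / 2 * ρ y)) :=
          Finset.sum_le_sum fun x _ => Finset.sum_le_sum fun y _ =>
            mul_le_mul_of_nonneg_left (pt x y) (nn_nonneg x y)
      _ = ε / 2 * ∑ x, wall s x + 1 / (2 * ε) * (∑ x, ∑ y, nn x y * ((1 - s x) / 2 * ρ x)
          + ∑ x, ∑ y, nn x y * ((1 - s y) / 2 * ρ y)) := by
          simp only [wall, Finset.mul_sum, ← Finset.sum_add_distrib]
          refine Finset.sum_congr rfl fun x _ => Finset.sum_congr rfl fun y _ => ?_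
          ring
      _ = _ := by
          rw [e1, e2]
          field_simp
          ring
  rw [trace_kinetic_mul_re, trace_kinetic_mul_re]
  simp only [entry]
  -- Removing density `ρ x` changes the diagonal energy by `(μ - 2 d) ρ x`, at most `2 d ρ x` as `μ
  -- < 4 d`.
  have hdiag : ∑ x, (2 * d - μ) * ((1 + s x) / 2 * ((1 + s x) / 2) * (X x x).re)
      ≤ ∑ x, (2 * d - μ) * (X x x).re + 2 * d * ∑ x, (1 - s x) / 2 * ρ x := by
    rw [Finset.mul_sum, ← Finset.sum_add_distrib]
    refine Finset.sum_le_sum fun x _ => ?_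
    change _ * (_ * ρ x) ≤ _ * ρ x + _
    rcases hs x with hx | hx <;> rw [hx]
    · norm_num
    · norm_num
      nlinarith [hρ0 x]
  have e : 2 * (d : ℝ) * (1 + 1 / ε) * ∑ x, (1 - s x) / 2 * ρ x
      = 2 * d * ∑ x, (1 - s x) / 2 * ρ x + 2 * d / ε * ∑ x, (1 - s x) / 2 * ρ x := by ring
  rw [e]
  linarith

/-- `X` on the sites with `s = 1` and `Y` on those with `s = -1`. -/
noncomputable def glue (s : Lattice d L → ℝ) (X Y : Matrix (Lattice d L) (Lattice d L) ℂ) :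
    Matrix (Lattice d L) (Lattice d L) ℂ :=
  diagonal (fun x => (((1 + s x) / 2 : ℝ) : ℂ)) * X * diagonal (fun x => (((1 + s x) / 2 : ℝ) : ℂ))
    + diagonal (fun x => (((1 + -s x) / 2 : ℝ) : ℂ)) * Y *
      diagonal (fun x => (((1 + -s x) / 2 : ℝ) : ℂ))

theorem glue_apply (s : Lattice d L → ℝ) (X Y : Matrix (Lattice d L) (Lattice d L) ℂ)
    (x y : Lattice d L) :
    glue s X Y x y = (((1 + s x) / 2 : ℝ) : ℂ) * X x y * (((1 + s y) / 2 : ℝ) : ℂ)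
      + (((1 + -s x) / 2 : ℝ) : ℂ) * Y x y * (((1 + -s y) / 2 : ℝ) : ℂ) := by
  rw [glue, Matrix.add_apply, mul_diagonal, diagonal_mul, mul_diagonal, diagonal_mul]

theorem glue_posSemidef (s : Lattice d L → ℝ) {X Y : Matrix (Lattice d L) (Lattice d L) ℂ}
    (hX : X.PosSemidef) (hY : Y.PosSemidef) : (glue s X Y).PosSemidef := by
  have h : ∀ (a : Lattice d L → ℝ) {Z : Matrix (Lattice d L) (Lattice d L) ℂ}, Z.PosSemidef →
      (diagonal (fun x => (a x : ℂ)) * Z * diagonal fun x => (a x : ℂ)).PosSemidef := by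
    intro a Z hZ
    have := hZ.conjTranspose_mul_mul_same (diagonal fun x => (a x : ℂ))
    have e : star (fun x => (a x : ℂ)) = fun x => (a x : ℂ) := by
      ext x
      exact Complex.conj_ofReal _
    rwa [diagonal_conjTranspose, e] at this
  exact (h _ hX).add (h _ hY)

/-- For signs `±1` the two compressions sum to the identity on `1`, so gluing intertwines `X ↦ 1 -
X`. -/
theorem glue_isDensityMatrix {s : Lattice d L → ℝ} (hs : ∀ x, s x = 1 ∨ s x = -1)
    {X Y : Matrix (Lattice d L) (Lattice d L) ℂ} (hX : IsDensityMatrix X)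
    (hY : IsDensityMatrix Y) : IsDensityMatrix (glue s X Y) := by
  refine ⟨glue_posSemidef s hX.1 hY.1, ?_⟩
  have e : 1 - glue s X Y = glue s (1 - X) (1 - Y) := by
    ext x y
    rw [Matrix.sub_apply, glue_apply, glue_apply, Matrix.sub_apply, Matrix.sub_apply]
    by_cases hxy : x = y
    · subst hxy
      rcases hs x with hx | hx <;> simp [hx]
    · rw [Matrix.one_apply_ne hxy]
      ring
  rw [e]
  exact glue_posSemidef s hX.2 hY.2

theorem glue_commute {s : Lattice d L → ℝ} (hs : ∀ x, s x = 1 ∨ s x = -1)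
    (X Y : Matrix (Lattice d L) (Lattice d L) ℂ) :
    Commute (glue s X Y) (diagonal fun x => (s x : ℂ)) := by
  ext x y
  rw [mul_diagonal, diagonal_mul, glue_apply]
  rcases hs x with hx | hx <;> rcases hs y with hy | hy <;> simp [hx, hy]

theorem glue_spinSign_diag (X Y : Matrix (Lattice d L) (Lattice d L) ℂ) (x : Lattice d L) :
    (glue (spinSign X Y) X Y x x).re = max (X x x).re (Y x x).re := by
  rw [glue_apply, spinSign]
  split_ifs with h
  · simp [max_eq_left h]
  · simp [max_eq_right (not_le.1 h).le]

theorem wall_neg (s : Lattice d L → ℝ) (x : Lattice d L) : wall (fun x => -s x) x = wall s x := by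
  simp [wall]

/-- The coercive lower bound: the energy exceeds that of the filled Fermi sea by a multiple of
the length of the wall and of the number of sites of low density, and by the number of doubly
occupied sites. -/
theorem exists_functional_lower_bound {μ : ℝ} (hμ : 0 < μ) (hμd : μ < 4 * d) :
    ∃ κ θ U₀ : ℝ, 0 < κ ∧ 0 ≤ U₀ ∧ ∃ L₀ : ℕ, 3 ≤ L₀ ∧ ∀ (L : ℕ) [NeZero L], L₀ ≤ L →
      ∀ U : ℝ, U₀ ≤ U → ∀ X Y : Matrix (Lattice d L) (Lattice d L) ℂ,
        IsDensityMatrix X → IsDensityMatrix Y →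
        ∑ k : Lattice d L, min (dispersion k - μ) 0 + (κ * ∑ x, wall (spinSign X Y) x
          + ∑ x, if max (X x x).re (Y x x).re < θ then κ else min (X x x).re (Y x x).re)
          ≤ functional μ U X Y := by
  obtain ⟨η, c, hη, hc, L₀, hfrac⟩ := exists_fraction hμ hμd
  have hd : (0 : ℝ) < d := by linarith
  -- `16 d²` is the bound on the squared dispersion, so `c₁ ε² ≤ c` on the whole band.
  obtain ⟨c₁, hc₁, hc₁d⟩ : ∃ c₁ : ℝ, 0 < c₁ ∧ c₁ * (16 * d ^ 2) = c :=
    ⟨c / (16 * d ^ 2), by positivity, by field_simp⟩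
  -- Half of `η * D` goes to the wall and half to the sites of low density. Each yields `2 κ` per
  -- unit: one `κ` is kept in the bound, the other pays for gluing.
  obtain ⟨κ, hκ, hκ1, hκ2⟩ : ∃ κ : ℝ, 0 < κ ∧ 2 * κ ≤ η * c₁ / 2 ∧ 2 * κ ≤ η * (c / 2) ^ 2 / 2 :=
    ⟨min (η * c₁ / 4) (η * (c / 2) ^ 2 / 4), by positivity,
      by linarith [min_le_left (η * c₁ / 4) (η * (c / 2) ^ 2 / 4)],
      by linarith [min_le_right (η * c₁ / 4) (η * (c / 2) ^ 2 / 4)]⟩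
  obtain ⟨ε, hε, hε1, hεκ⟩ : ∃ ε : ℝ, 0 < ε ∧ ε ≤ 1 ∧ ε ≤ κ :=
    ⟨min 1 κ, by positivity, min_le_left _ _, min_le_right _ _⟩
  obtain ⟨C, hC, hCd⟩ : ∃ C : ℝ, 0 < C ∧ C = 2 * d * (1 + 1 / ε) := ⟨_, by positivity, rfl⟩
  obtain ⟨θ, hθ, hθc, hθC⟩ : ∃ θ : ℝ, 0 < θ ∧ θ ≤ (c / 2) ^ 2 ∧ C * θ ≤ κ :=
    ⟨min ((c / 2) ^ 2) (κ / C), by positivity, min_le_left _ _, by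
      calc C * min ((c / 2) ^ 2) (κ / C) ≤ C * (κ / C) := by gcongr; exact min_le_right _ _
        _ = κ := by field_simp⟩
  refine ⟨κ, θ, (C + 1) / θ, hκ, by positivity, max 3 L₀, le_max_left _ _, ?_⟩
  intro L _ hL U hU X Y hX hY
  have hL3 : 3 ≤ L := (le_max_left _ _).trans hL
  obtain ⟨hov, hn⟩ := hfrac L ((le_max_right _ _).trans hL)
  have hUθ : C + 1 ≤ U * θ := (div_le_iff₀ hθ).1 hU
  have hU0 : 0 ≤ U := le_trans (by positivity) hU
  set s := spinSign X Y with hsdef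
  have hs : ∀ x, s x = 1 ∨ s x = -1 := spinSign_eq X Y
  set h : Lattice d L → ℝ := lowSymbol (μ - η) with hh
  set g : Lattice d L → ℝ := highSymbol (μ + η) with hg
  have hh2 : h * h = h := by
    ext k
    simp only [Pi.mul_apply, hh, lowSymbol]
    split_ifs <;> norm_num
  have hg2 : g * g = g := by
    ext k
    simp only [Pi.mul_apply, hg, highSymbol]
    split_ifs <;> norm_num
  have hhη : ∀ k, η * h k ≤ max (-(dispersion k - μ)) 0 := by
    intro k
    simp only [hh, lowSymbol]
    split_ifs
    · exact le_max_of_le_left (by linarith)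
    · simp
  have hgη : ∀ k, η * g k ≤ max (dispersion k - μ) 0 := by
    intro k
    simp only [hg, highSymbol]
    split_ifs
    · exact le_max_of_le_left (by linarith)
    · simp
  have hovd : ∀ k, c₁ * (dispersion k ^ 2 - dispersion k) ≤ overlap h g k := by
    intro k
    have h0 := dispersion_nonneg k
    have h4 := dispersion_le k
    by_cases h1 : 1 ≤ dispersion k
    · refine le_trans ?_ (hov k h1)
      rw [← hc₁d]
      gcongr
      nlinarith
    · have : 0 ≤ overlap h g k := by
        refine mul_nonneg (by positivity) (Finset.sum_nonneg fun q _ => ?_)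
        simp only [hh, hg, lowSymbol, highSymbol]
        split_ifs <;> norm_num
      refine le_trans ?_ this
      refine mul_nonpos_of_nonneg_of_nonpos hc₁.le ?_
      nlinarith
  set γ := glue s X Y with hγdef
  have hγ : IsDensityMatrix γ := glue_isDensityMatrix hs hX hY
  have hHH : multiplier h * multiplier h = multiplier h := by rw [← multiplier_mul, hh2]
  have hGG : multiplier g * multiplier g = multiplier g := by rw [← multiplier_mul, hg2]
  have hE := le_trace_multiplier_mul hhη hgη hγ
  rw [← kinetic_eq_multiplier hL3] at hE
  have hW := (sum_wall_le hL3 hs hh2 hg2 hc₁.le hovd).trans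
    (hγ.hsSq_mul_diagonal_mul_le (multiplier_isHermitian g) hGG (multiplier_isHermitian h) hHH
      (s := fun x => (s x : ℂ)) (fun x => by rcases hs x with h | h <;> simp [h])
      (glue_commute hs X Y))
  have hlow := hγ.card_low_mul_le (multiplier_isHermitian h) hHH (a := c / 2) (θ := θ)
    (by positivity) (fun x => by
      rw [multiplier_diag, Complex.ofReal_re]
      linarith) hθc
  have hG0 := (hsSq_nonneg _).trans (hγ.hsSq_mul_projection_le (multiplier_isHermitian g) hGG)
  set D := (multiplier g * γ).trace.re + (multiplier h * (1 - γ)).trace.re with hD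
  have hTX := trace_kinetic_restrict_le hμd hL3 hX hs hε hε1
  have hTY := trace_kinetic_restrict_le hμd hL3 hY (s := fun x => -s x)
    (fun x => by rcases hs x with h | h <;> simp [h]) hε hε1
  simp only [wall_neg] at hTY
  have hWn : 0 ≤ ∑ x, wall s x := Finset.sum_nonneg fun x _ => wall_nonneg hs x
  have hγtr : (kinetic d L μ * γ).trace.re ≤ (kinetic d L μ * (X + Y)).trace.re
      + ε * ∑ x, wall s x + C * ∑ x, min (X x x).re (Y x x).re := by
    rw [hγdef, glue, mul_add, trace_add, Complex.add_re, mul_add, trace_add, Complex.add_re, hCd]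
    have : ∑ x, min (X x x).re (Y x x).re = ∑ x, (1 - s x) / 2 * (X x x).re
        + ∑ x, (1 - -s x) / 2 * (Y x x).re := by
      rw [← Finset.sum_add_distrib]
      exact Finset.sum_congr rfl fun x _ => (removed_spinSign X Y x).symm
    rw [this, mul_add (2 * (d : ℝ) * (1 + 1 / ε))]
    linarith
  have hcard : ((Finset.univ.filter fun x => (γ x x).re < θ).card : ℝ)
      = ∑ x, if max (X x x).re (Y x x).re < θ then (1 : ℝ) else 0 := by
    rw [Finset.card_filter]
    push_cast
    refine Finset.sum_congr rfl fun x _ => ?_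
    rw [hγdef, hsdef, glue_spinSign_diag]
  -- Site by site: below density `θ` the gluing cost is at most `C θ ≤ κ`; otherwise the product of
  -- densities is at least `θ` times the smaller one, and `U θ ≥ C + 1`.
  have hpt : ∑ x, (if max (X x x).re (Y x x).re < θ then κ else min (X x x).re (Y x x).re)
      + C * ∑ x, min (X x x).re (Y x x).re
      ≤ 2 * κ * (∑ x, if max (X x x).re (Y x x).re < θ then (1 : ℝ) else 0)
        + U * ∑ x, (X x x).re * (Y x x).re := by
    rw [Finset.mul_sum, Finset.mul_sum, Finset.mul_sum, ← Finset.sum_add_distrib,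
      ← Finset.sum_add_distrib]
    refine Finset.sum_le_sum fun x _ => ?_
    have h1 := PosSemidef.diag_re_nonneg hX.1 x
    have h2 := PosSemidef.diag_re_nonneg hY.1 x
    rw [← min_mul_max (X x x).re (Y x x).re]
    have h3 : 0 ≤ min (X x x).re (Y x x).re := le_min h1 h2
    have h4 := min_le_max (a := (X x x).re) (b := (Y x x).re)
    generalize min (X x x).re (Y x x).re = m at *
    generalize max (X x x).re (Y x x).re = M at *
    split_ifs with hM
    · have h5 : C * m ≤ C * θ := by gcongr; linarith
      have h6 : 0 ≤ U * (m * M) := mul_nonneg hU0 (mul_nonneg h3 (h3.trans h4))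
      linarith
    · have h5 : U * (m * θ) ≤ U * (m * M) := by gcongr; linarith
      have h6 : (C + 1) * m ≤ U * θ * m := by gcongr
      linarith
  rw [hcard] at hlow
  set Z := ∑ x, if max (X x x).re (Y x x).re < θ then (1 : ℝ) else 0 with hZ
  have hZ0 : 0 ≤ Z := Finset.sum_nonneg fun x _ => by split_ifs <;> norm_num
  have hDb : 2 * κ * ∑ x, wall s x + 2 * κ * Z ≤ η * D := by
    have h1 : c₁ * ∑ x, wall s x ≤ D := by linarith
    have h2 : Z * (c / 2) ^ 2 ≤ D := by linarith
    have h3 := mul_le_mul_of_nonneg_left h1 hη.le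
    have h4 := mul_le_mul_of_nonneg_left h2 hη.le
    have h5 := mul_le_mul_of_nonneg_right hκ1 hWn
    have h6 := mul_le_mul_of_nonneg_right hκ2 hZ0
    linarith
  have hεW := mul_le_mul_of_nonneg_right hεκ hWn
  rw [functional]
  linarith

end Energy

end HFz

namespace HFz

/-! ### The Fermi sea and the characterization of minimizers -/

section Minimizers

open Matrix
open scoped ComplexOrder

variable {d L : ℕ}

theorem functional_swap (μ U : ℝ) [NeZero L] (X Y : Matrix (Lattice d L) (Lattice d L) ℂ) :
    functional μ U X Y = functional μ U Y X := by
  simp only [functional, add_comm X Y, mul_comm (X _ _).re]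

/-- The indicator of the momenta below the chemical potential. -/
noncomputable def fermiSea (μ : ℝ) (k : Lattice d L) : ℝ := if dispersion k < μ then 1 else 0

theorem fermiSea_mul_self (μ : ℝ) :
    (fermiSea μ : Lattice d L → ℝ) * fermiSea μ = fermiSea μ := by
  ext k
  simp only [Pi.mul_apply, fermiSea]
  split_ifs <;> norm_num

theorem eq_zero_of_min_diag {X Y : Matrix (Lattice d L) (Lattice d L) ℂ} (hY : Y.PosSemidef)
    (hmin : ∀ x, min (X x x).re (Y x x).re = 0) (hs : ∀ x, spinSign X Y x = 1) : Y = 0 := by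
  refine PosSemidef.eq_zero_of_diag hY fun x => ?_
  have h1 := hs x
  have h2 := hmin x
  rw [spinSign] at h1
  split_ifs at h1 with h
  · rwa [min_eq_right h] at h2
  · norm_num at h1

theorem eq_zero_of_min_diag' {X Y : Matrix (Lattice d L) (Lattice d L) ℂ} (hX : X.PosSemidef)
    (hmin : ∀ x, min (X x x).re (Y x x).re = 0) (hs : ∀ x, spinSign X Y x = -1) : X = 0 := by
  refine PosSemidef.eq_zero_of_diag hX fun x => ?_
  have h1 := hs x
  have h2 := hmin x
  rw [spinSign] at h1
  split_ifs at h1 with h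
  · norm_num at h1
  · rwa [min_eq_left (not_le.1 h).le] at h2

variable [NeZero L]

/-- The trace of the function `min t 0` of the operator, computed once through its eigenvalues and
once through its symbol, so no matching of the two lists is needed. -/
theorem negTrace_kinetic (hL : 3 ≤ L) (μ : ℝ) :
    negTrace (kinetic_isHermitian d L μ) = ∑ k : Lattice d L, min (dispersion k - μ) 0 := by
  have h := trace_cfc (kinetic_isHermitian d L μ) fun t => min t 0
  rw [cfc_multiplier _ (kinetic_eq_multiplier hL μ), trace_multiplier] at h
  exact (Complex.ofReal_injective h).symm

theorem spectralProjLT_neg_laplacian (hL : 3 ≤ L) (μ : ℝ) :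
    spectralProjLT (neg_laplacian_isHermitian d L) μ = multiplier (fermiSea μ) := by
  rw [spectralProjLT, cfc_multiplier _ (multiplier_dispersion hL)]
  rfl

theorem fermiSea_isStarProjection (μ : ℝ) :
    IsStarProjection (multiplier (fermiSea μ : Lattice d L → ℝ)) :=
  ⟨by rw [IsIdempotentElem, ← multiplier_mul, fermiSea_mul_self], multiplier_isHermitian _⟩

theorem functional_fermiSea (hL : 3 ≤ L) (μ U : ℝ) :
    functional μ U (multiplier (fermiSea μ : Lattice d L → ℝ)) 0
      = ∑ k : Lattice d L, min (dispersion k - μ) 0 := by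
  rw [functional, add_zero, kinetic_eq_multiplier hL, ← multiplier_mul, trace_multiplier,
    Complex.ofReal_re]
  simp only [Matrix.zero_apply, Complex.zero_re, mul_zero, Finset.sum_const_zero, add_zero]
  refine Finset.sum_congr rfl fun k _ => ?_
  simp only [Pi.mul_apply, fermiSea]
  split_ifs with h
  · rw [min_eq_left (by linarith), mul_one]
  · rw [min_eq_right (by linarith), mul_zero]

theorem isDensityMatrix_of_isStarProjection {n : Type*} [Fintype n] [DecidableEq n]
    {P : Matrix n n ℂ} (hP : IsStarProjection P) : IsDensityMatrix P := by
  have h : ∀ {Q : Matrix n n ℂ}, IsStarProjection Q → Q.PosSemidef := by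
    intro Q hQ
    have e : Q = Qᴴ * Q := by
      rw [← star_eq_conjTranspose, hQ.isSelfAdjoint.star_eq, hQ.isIdempotentElem.eq]
    rw [e]
    exact posSemidef_conjTranspose_mul_self Q
  exact ⟨h hP, h hP.one_sub⟩

theorem hasEigenvalue_neg_laplacian (hL : 3 ≤ L) (k : Lattice d L) :
    Module.End.HasEigenvalue (Matrix.toLin' (-laplacian d L)) (dispersion k : ℂ) := by
  refine Module.End.hasEigenvalue_of_hasEigenvector (x := planeWave k) ⟨?_, ?_⟩
  · rw [Module.End.mem_eigenspace_iff, toLin'_apply, multiplier_dispersion hL]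
    ext x
    exact multiplier_mulVec_planeWave _ _ _
  · intro h
    have := congrFun h 0
    simp at this

/-- Away from the spectrum, the Fermi sea is the only minimizer of the kinetic energy. -/
theorem eq_fermiSea_of_trace_le (hL : 3 ≤ L) {μ : ℝ}
    (hμ : ∀ k : Lattice d L, dispersion k ≠ μ) {X : Matrix (Lattice d L) (Lattice d L) ℂ}
    (hX : IsDensityMatrix X)
    (h : (kinetic d L μ * X).trace.re ≤ ∑ k : Lattice d L, min (dispersion k - μ) 0) :
    X = multiplier (fermiSea μ) := by
  -- The distance from `μ` to the finite spectrum serves as the gap `η`, with the Fermi sea and its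
  -- complement as low and high momenta. No excess then forces `X G = 0` and `(1 - X) H = 0`, hence
  -- `X = X H = H`.
  obtain ⟨k₀, hk₀⟩ := Finite.exists_min fun k : Lattice d L => |dispersion k - μ|
  have hη : 0 < |dispersion k₀ - μ| := abs_pos.2 (sub_ne_zero.2 (hμ k₀))
  have h1 := le_trace_multiplier_mul (w := fun k : Lattice d L => dispersion k - μ)
    (h := fermiSea μ) (g := 1 - fermiSea μ) (η := |dispersion k₀ - μ|)
    (fun k => by
      have := hk₀ k
      simp only [fermiSea]
      split_ifs with hk
      · rw [abs_of_neg (sub_neg.2 hk)] at this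
        exact le_max_of_le_left (by linarith)
      · simp)
    (fun k => by
      have := hk₀ k
      simp only [Pi.sub_apply, Pi.one_apply, fermiSea]
      split_ifs with hk
      · simp
      · rw [abs_of_nonneg (sub_nonneg.2 (not_lt.1 hk))] at this
        exact le_max_of_le_left (by linarith)) hX
  rw [← kinetic_eq_multiplier hL] at h1
  have hP := fermiSea_isStarProjection (d := d) (L := L) μ
  have hQ : multiplier (1 - fermiSea μ : Lattice d L → ℝ) = 1 - multiplier (fermiSea μ) := by
    rw [multiplier_sub, multiplier_one]
  have h2 := hX.hsSq_mul_projection_le (multiplier_isHermitian (1 - fermiSea μ))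
    (by rw [hQ]; exact hP.one_sub.isIdempotentElem.eq)
  have h3 := hX.one_sub.hsSq_mul_projection_le (multiplier_isHermitian (fermiSea μ))
    hP.isIdempotentElem.eq
  have n2 := hsSq_nonneg (X * multiplier (1 - fermiSea μ))
  have n3 := hsSq_nonneg ((1 - X) * multiplier (fermiSea μ))
  have h4 : (multiplier (1 - fermiSea μ) * X).trace.re
      + (multiplier (fermiSea μ) * (1 - X)).trace.re ≤ 0 := by
    by_contra hcon
    have := mul_pos hη (not_le.1 hcon)
    linarith
  have z2 := eq_zero_of_hsSq_eq_zero (le_antisymm (by linarith) n2)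
  have z3 := eq_zero_of_hsSq_eq_zero (le_antisymm (by linarith) n3)
  rw [hQ, mul_sub, mul_one, sub_eq_zero] at z2
  rw [sub_mul, one_mul, sub_eq_zero] at z3
  rw [z2, ← z3]

theorem wall_eq_zero_imp {s : Lattice d L → ℝ} (hL : 3 ≤ L) (hs : ∀ x, s x = 1 ∨ s x = -1)
    (hw : ∀ x, wall s x = 0) : (∀ x, s x = 1) ∨ ∀ x, s x = -1 := by
  have h : ∀ x y, s x = s y := by
    refine eq_of_forall_nn hL s fun x y hxy => ?_
    have h0 := (Finset.sum_eq_zero_iff_of_nonneg (fun y _ => by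
      rcases wall_term hs x y with h | h <;> rw [h]; norm_num)).1 (hw x) y (Finset.mem_univ y)
    rw [hxy] at h0
    rcases hs x with h1 | h1 <;> rcases hs y with h2 | h2 <;> rw [h1, h2] at h0 ⊢ <;> norm_num at h0
  rcases hs 0 with h0 | h0
  · exact Or.inl fun x => (h x 0).trans h0
  · exact Or.inr fun x => (h x 0).trans h0

/-- A pair without excess energy is fully polarized. -/
theorem eq_zero_or_eq_zero_of_excess (hL : 3 ≤ L) {κ θ : ℝ} (hκ : 0 < κ)
    {X Y : Matrix (Lattice d L) (Lattice d L) ℂ} (hX : IsDensityMatrix X) (hY : IsDensityMatrix Y)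
    (h : κ * ∑ x, wall (spinSign X Y) x
      + ∑ x, (if max (X x x).re (Y x x).re < θ then κ else min (X x x).re (Y x x).re) ≤ 0) :
    Y = 0 ∨ X = 0 := by
  have hs := spinSign_eq X Y
  have hw := fun x => wall_nonneg hs x
  have hm : ∀ x, 0 ≤ min (X x x).re (Y x x).re := fun x =>
    le_min (PosSemidef.diag_re_nonneg hX.1 x) (PosSemidef.diag_re_nonneg hY.1 x)
  have hm' : ∀ x ∈ Finset.univ,
      0 ≤ if max (X x x).re (Y x x).re < θ then κ else min (X x x).re (Y x x).re := fun x _ => by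
    split_ifs
    exacts [hκ.le, hm x]
  have h1 := mul_nonneg hκ.le (Finset.sum_nonneg fun x (_ : x ∈ Finset.univ) => hw x)
  have h2 := Finset.sum_nonneg hm'
  have h3 : ∑ x, wall (spinSign X Y) x = 0 :=
    (mul_eq_zero.1 (le_antisymm (by linarith) h1)).resolve_left hκ.ne'
  have hw0 : ∀ x, wall (spinSign X Y) x = 0 := fun x =>
    (Finset.sum_eq_zero_iff_of_nonneg fun x _ => hw x).1 h3 x (Finset.mem_univ x)
  have hmin : ∀ x, min (X x x).re (Y x x).re = 0 := by
    intro x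
    have h4 := (Finset.sum_eq_zero_iff_of_nonneg hm').1 (le_antisymm (by linarith) h2) x
      (Finset.mem_univ x)
    split_ifs at h4
    · exact absurd h4 hκ.ne'
    · exact h4
  rcases wall_eq_zero_imp hL hs hw0 with h | h
  · exact Or.inl (eq_zero_of_min_diag hY.1 hmin h)
  · exact Or.inr (eq_zero_of_min_diag' hX.1 hmin h)

end Minimizers

end HFz

theorem theorem1 (d : ℕ) (μ : ℝ) (hμ : 0 < μ) (hμd : μ < 4 * (d : ℝ)) :
    ∃ (L₀ : ℕ) (U₀ : ℝ), 0 ≤ U₀ ∧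
      ∀ (L : ℕ) [NeZero L], Even L → L₀ ≤ L → ∀ U : ℝ, U₀ ≤ U →
        IsLeast (HFz.projectionEnergies d L μ U)
            (HFz.negTrace (HFz.kinetic_isHermitian d L μ)) ∧
        IsLeast (HFz.densityEnergies d L μ U)
            (HFz.negTrace (HFz.kinetic_isHermitian d L μ)) ∧
        (¬ Module.End.HasEigenvalue (Matrix.toLin' (-HFz.laplacian d L)) (μ : ℂ) →
          ∀ γup γdn : Matrix (HFz.Lattice d L) (HFz.Lattice d L) ℂ,
            HFz.IsMinimizer μ U γup γdn →
              (γup = HFz.spectralProjLT (HFz.neg_laplacian_isHermitian d L) μ ∧ γdn = 0) ∨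
              (γup = 0 ∧ γdn = HFz.spectralProjLT (HFz.neg_laplacian_isHermitian d L) μ)) := by
  obtain ⟨κ, θ, U₀, hκ, hU₀, L₀, hL₀, hmain⟩ := HFz.exists_functional_lower_bound hμ hμd
  refine ⟨L₀, U₀, hU₀, fun L _ _ hL U hU => ?_⟩
  have hL3 : 3 ≤ L := hL₀.trans hL
  have hbound := hmain L hL U hU
  rw [HFz.negTrace_kinetic hL3, HFz.spectralProjLT_neg_laplacian hL3]
  have hnonneg : ∀ X Y : Matrix (HFz.Lattice d L) (HFz.Lattice d L) ℂ,
      HFz.IsDensityMatrix X → HFz.IsDensityMatrix Y →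
      ∑ k : HFz.Lattice d L, min (HFz.dispersion k - μ) 0 ≤ HFz.functional μ U X Y := by
    intro X Y hX hY
    refine le_trans ?_ (hbound X Y hX hY)
    refine le_add_of_nonneg_right (add_nonneg (mul_nonneg hκ.le (Finset.sum_nonneg fun x _ =>
      HFz.wall_nonneg (HFz.spinSign_eq X Y) x)) (Finset.sum_nonneg fun x _ => ?_))
    split_ifs
    exacts [hκ.le, le_min (HFz.PosSemidef.diag_re_nonneg hX.1 x)
      (HFz.PosSemidef.diag_re_nonneg hY.1 x)]
  have hP := HFz.fermiSea_isStarProjection (d := d) (L := L) μ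
  have hPE := HFz.functional_fermiSea (d := d) hL3 μ U
  have hdens : IsLeast (HFz.densityEnergies d L μ U)
      (∑ k : HFz.Lattice d L, min (HFz.dispersion k - μ) 0) := by
    refine ⟨⟨_, 0, HFz.isDensityMatrix_of_isStarProjection hP,
      HFz.isDensityMatrix_of_isStarProjection (.zero _), hPE⟩, ?_⟩
    rintro E ⟨X, Y, hX, hY, rfl⟩
    exact hnonneg X Y hX hY
  refine ⟨⟨⟨_, 0, hP, .zero _, hPE⟩, ?_⟩, hdens, ?_⟩
  · rintro E ⟨X, Y, hX, hY, rfl⟩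
    exact hnonneg X Y (HFz.isDensityMatrix_of_isStarProjection hX)
      (HFz.isDensityMatrix_of_isStarProjection hY)
  · rintro hspec X Y ⟨hX, hY, hmin⟩
    have hne : ∀ k : HFz.Lattice d L, HFz.dispersion k ≠ μ := fun k hk =>
      hspec (hk ▸ HFz.hasEigenvalue_neg_laplacian hL3 k)
    have hE := hmin.unique hdens
    have hb := hbound X Y hX hY
    have key : ∀ Z : Matrix (HFz.Lattice d L) (HFz.Lattice d L) ℂ, HFz.IsDensityMatrix Z →
        HFz.functional μ U Z 0 = ∑ k : HFz.Lattice d L, min (HFz.dispersion k - μ) 0 →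
        Z = HFz.multiplier (HFz.fermiSea μ) := by
      intro Z hZ h
      refine HFz.eq_fermiSea_of_trace_le hL3 hne hZ ?_
      rw [← h, HFz.functional]
      simp
    -- The energy equals that of the Fermi sea, so the coercive bound leaves no room for excess.
    rcases HFz.eq_zero_or_eq_zero_of_excess hL3 hκ hX hY (by linarith) with h | h
    · subst h
      exact Or.inl ⟨key X hX hE, rfl⟩
    · subst h
      exact Or.inr ⟨rfl, key Y hY (by rw [HFz.functional_swap, hE])⟩
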